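/- Let $U$ and $V$ be blocks of $n=|U|$ and $m=|V|\ge 2$ Boolean variables. Let $\varphi(U,V)$ be a satisfiable circuit formula, i.e. any two satisfying assignments of $\varphi$ that agree on $U$ are equal. All logarithms are to base $2$. Write $\mathrm{sol}(\cdot)$ for the set of satisfying assignments and $\downarrow U$ for projection to $U$. For $\sigma\in\{0,1\}^V$ let $p_\sigma=|\mathrm{sol}(\varphi(V\mapsto\sigma))|/|\mathrm{sol}(\varphi)_{\downarrow U}|$, and let $H(\varphi)=-\sum_{\sigma}p_\sigma\log p_\sigma$ (with $0\log 0=0$). The algorithm has access to exact (projected) model counters and to a uniform sampler of satisfying assignments (whose answer on an unsatisfiable formula may be arbitrary). For $S\subseteq\{0,1\}^V$, $\mathsf{PROC}(S)$ is the following procedure: let $\psi$ be a formula over $V$ with solution set $S$; sample $\tau\in\mathrm{sol}(\varphi\wedge\psi)$ uniformly, put $\sigma=\tau_{\downarrow V}$, ask the counters for $|\mathrm{sol}(\varphi(V\mapsto\sigma))|$ and $|\mathrm{sol}(\varphi)_{\downarrow U}|$, and return $(\sigma,p_\sigma)$ with $p_\sigma$ their quotient. $\mathsf{SampleEst}(\bar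 S,t,\delta)$ repeats $T=\lceil\frac92\log\frac2\delta\rceil$ times (zero times if this is negative): draw $t$ independent samples $(y_j,r_j)$ from $\mathsf{PROC}(\{0,1\}^V\setminus\bar S)$ and record the mean of $\log(1/r_j)$; it returns the median of the recorded values. The modified $\mathsf{EntropyEstimation}(\varepsilon,\delta)$ makes up to $\lceil\log(10/\delta)\rceil$ calls $(x,r)\leftarrow\mathsf{PROC}(\{0,1\}^V)$. If one of them has $r>\frac12$, it immediately sets $$t=\frac6{\varepsilon^2}\min\Big\{\frac{n}{2\log\frac1{1-r}},\;m+\log(m+\log m+2.5)\Big\},$$ calls $\hat h_{rem}\leftarrow\mathsf{SampleEst}(\{x\},t,0.9\,\delta)$ and returns $(1-r)\hat h_{rem}+r\log\frac1r$. If none has, it sets $$t=\frac6{\varepsilon^2}\big(\min\{n,\;m+\log(m+\log m+1.1)\}-1\big)$$ and returns $\mathsf{SampleEst}(\varnothing,t,0.9\,\delta)$. Here $t$ is rounded up to an integer and to at least $1$, and the quotient in the first formula is read as $0$ when $r=1$. Then there is an absolute constant $C>0$ such that, for all such $\varphi$ and all $\varepsilon,\delta>0$: 1. every nonzero $p_\sigma$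 is at least $2^{-n}$; 2. the returned value $\hat h$ satisfies $\Pr\big[(1-\varepsilon)H(\varphi)\le\hat h\le(1+\varepsilon)H(\varphi)\big]\ge 1-\delta$; 3. on every run, the number of counting and sampling queries is at most $C\cdot\max\{1,\min(m,n)/\varepsilon^2\}\cdot\max\{1,\log(1/\delta)\}$; in particular it is $O\big(\frac{\min(m,n)}{\varepsilon^2}\log\frac1\delta\big)$ when $\min(m,n)\ge\varepsilon^2$ and $\delta\le\frac12$. -/

import Mathlib

/-- Propositional formulas over a set `X` of variables. -/
inductive PropForm (X : Type) : Type
  | const (b : Bool) : PropForm X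
  | var (x : X) : PropForm X
  | neg (φ : PropForm X) : PropForm X
  | and (φ ψ : PropForm X) : PropForm X
  | or (φ ψ : PropForm X) : PropForm X

namespace PropForm

/-- Truth value of a formula under an assignment. -/
def eval {X : Type} (τ : X → Bool) : PropForm X → Bool
  | const b => b
  | var x => τ x
  | neg φ => !(eval τ φ)
  | and φ ψ => eval τ φ && eval τ ψ
  | or φ ψ => eval τ φ || eval τ ψ

/-- Simultaneous substitution of formulas for variables. -/
def subst {X Y : Type} (f : X → PropForm Y) : PropForm X → PropForm Y
  | const b => const b
  | var x => f x
  | neg φ => neg (subst f φ)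
  | and φ ψ => and (subst f φ) (subst f ψ)
  | or φ ψ => or (subst f φ) (subst f ψ)

/-- `sol(φ)`: the set of satisfying assignments. -/
def sol {X : Type} [Fintype X] [DecidableEq X] (φ : PropForm X) : Finset (X → Bool) :=
  Finset.univ.filter fun τ => φ.eval τ = true

/-- `sol(φ)↓P`: the set of solutions projected on the set `P` of variables. -/
def projSol {X : Type} [Fintype X] [DecidableEq X] (φ : PropForm X) (P : Finset X) :
    Finset (P → Bool) :=
  φ.sol.image fun τ => P.restrict τ

/-- The formula over the variables `v₁, …, v_m` whose only non-solution is `x`. -/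
def neAssignment {m : ℕ} (x : Fin m → Bool) : PropForm (Fin m) :=
  neg ((List.finRange m).foldr
    (fun v ψ => and (if x v then var v else neg (var v)) ψ) (const true))

/-! A formula over the two blocks `U` (`n` variables) and `V` (`m` variables) is a
`PropForm (Fin n ⊕ Fin m)`. -/

/-- The block `U` as a set of variables. -/
def blockU (n m : ℕ) : Finset (Fin n ⊕ Fin m) :=
  Finset.univ.map Function.Embedding.inl

/-- The formula `φ(V ↦ σ)` over the variables `U`. -/
def fixV {n m : ℕ} (φ : PropForm (Fin n ⊕ Fin m)) (σ : Fin m → Bool) : PropForm (Fin n) :=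
  φ.subst (Sum.elim var fun v => const (σ v))

/-- A formula over `V` regarded as a formula over `U ∪ V`. -/
def liftV {n m : ℕ} (ψ : PropForm (Fin m)) : PropForm (Fin n ⊕ Fin m) :=
  ψ.subst fun v => var (Sum.inr v)

/-- `φ(U,V)` is a circuit formula: two solutions that agree on `U` are equal. -/
def IsCircuit {n m : ℕ} (φ : PropForm (Fin n ⊕ Fin m)) : Prop :=
  ∀ τ₁ ∈ φ.sol, ∀ τ₂ ∈ φ.sol,
    (∀ u : Fin n, τ₁ (Sum.inl u) = τ₂ (Sum.inl u)) → τ₁ = τ₂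

/-- `p_σ = |sol(φ(V ↦ σ))| / |sol(φ)↓U|`. -/
noncomputable def outProb {n m : ℕ} (φ : PropForm (Fin n ⊕ Fin m)) (σ : Fin m → Bool) : ℝ :=
  ((φ.fixV σ).sol.card : ℝ) / ((φ.projSol (blockU n m)).card : ℝ)

/-- The entropy `H(φ) = - ∑_σ p_σ log₂ p_σ`. -/
noncomputable def entropy {n m : ℕ} (φ : PropForm (Fin n ⊕ Fin m)) : ℝ :=
  - ∑ σ : Fin m → Bool, φ.outProb σ * Real.logb 2 (φ.outProb σ)

end PropForm

/-- Queries to a model counter, to a projected model counter, and to a uniform sampler. -/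
inductive OracleQuery (n m : ℕ) : Type
  | count (ψ : PropForm (Fin n)) : OracleQuery n m
  | projCount (ψ : PropForm (Fin n ⊕ Fin m)) (P : Finset (Fin n ⊕ Fin m)) : OracleQuery n m
  | sample (ψ : PropForm (Fin n ⊕ Fin m)) : OracleQuery n m

/-- Counters answer with a number, samplers with an assignment. -/
abbrev OracleQuery.Answer {n m : ℕ} : OracleQuery n m → Type
  | count _ => ℕ
  | projCount _ _ => ℕ
  | sample _ => Fin n ⊕ Fin m → Bool

/-- Algorithms with access to the counting and sampling oracles: either return a value, or ask a
query and continue depending on the answer. -/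
inductive OracleAlg (n m : ℕ) (α : Type) : Type
  | ret (a : α) : OracleAlg n m α
  | ask (q : OracleQuery n m) (k : q.Answer → OracleAlg n m α) : OracleAlg n m α

namespace OracleAlg

/-- Sequential composition. -/
def seq {n m : ℕ} {α β : Type} : OracleAlg n m α → (α → OracleAlg n m β) → OracleAlg n m β
  | ret a, f => f a
  | ask q k, f => ask q fun ans => seq (k ans) f

instance {n m : ℕ} : Monad (OracleAlg n m) where
  pure := ret
  bind := seq

def count {n m : ℕ} (ψ : PropForm (Fin n)) : OracleAlg n m ℕ :=
  ask (.count ψ) fun ans => ret ans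

def projCount {n m : ℕ} (ψ : PropForm (Fin n ⊕ Fin m)) (P : Finset (Fin n ⊕ Fin m)) :
    OracleAlg n m ℕ :=
  ask (.projCount ψ P) fun ans => ret ans

def sample {n m : ℕ} (ψ : PropForm (Fin n ⊕ Fin m)) : OracleAlg n m (Fin n ⊕ Fin m → Bool) :=
  ask (.sample ψ) fun ans => ret ans

open Classical in
/-- The oracles. Counters are exact. The sampler returns a uniformly distributed solution of `ψ`;
when `ψ` has no solution it returns `junk ψ`, an arbitrary assignment. -/
noncomputable def answer {n m : ℕ}
    (junk : PropForm (Fin n ⊕ Fin m) → Fin n ⊕ Fin m → Bool) :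
    (q : OracleQuery n m) → PMF q.Answer
  | .count ψ => (PMF.pure ψ.sol.card : PMF ℕ)
  | .projCount ψ P => (PMF.pure (ψ.projSol P).card : PMF ℕ)
  | .sample ψ =>
      (if h : ψ.sol.Nonempty then PMF.uniformOfFinset ψ.sol h else PMF.pure (junk ψ) :
        PMF (Fin n ⊕ Fin m → Bool))

/-- The joint distribution of the returned value and of the number of queries asked; the answers
to different queries are drawn independently. -/
noncomputable def run {n m : ℕ} {α : Type}
    (junk : PropForm (Fin n ⊕ Fin m) → Fin n ⊕ Fin m → Bool) :
    OracleAlg n m α → PMF (α × ℕ)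
  | ret a => PMF.pure (a, 0)
  | ask q k => (answer junk q).bind fun ans =>
      (run junk (k ans)).map fun ac => (ac.1, ac.2 + 1)

end OracleAlg

/-- The median of a list of reals (the mean of the two middle entries if the length is even). -/
noncomputable def listMedian (L : List ℝ) : ℝ :=
  ((L.insertionSort (· ≤ ·)).getD ((L.length - 1) / 2) 0 +
    (L.insertionSort (· ≤ ·)).getD (L.length / 2) 0) / 2

namespace EntropyEstimation

open PropForm

/-- `PROC(S)` for the distribution `p` of `φ`, where `S` is the set of solutions of the formula `ψ`
over `V`: a pair `(σ, p_σ)` with `σ` drawn from `p` conditioned on `S`. One sampling query and two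
counting queries. -/
noncomputable def proc {n m : ℕ} (φ : PropForm (Fin n ⊕ Fin m)) (ψ : PropForm (Fin m)) :
    OracleAlg n m ((Fin m → Bool) × ℝ) := do
  let τ ← OracleAlg.sample (and φ (liftV ψ))
  let σ : Fin m → Bool := fun v => τ (Sum.inr v)
  let a ← OracleAlg.count (φ.fixV σ)
  let b ← OracleAlg.projCount φ (blockU n m)
  pure (σ, (a : ℝ) / (b : ℝ))

/-- Inner loop of `SampleEst`: `j` more samples, `est` being the sum so far. -/
noncomputable def sampleSum {n m : ℕ} (φ : PropForm (Fin n ⊕ Fin m)) (ψ : PropForm (Fin m)) :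
    ℕ → ℝ → OracleAlg n m ℝ
  | 0, est => pure est
  | j + 1, est => do
      let yr ← proc φ ψ
      sampleSum φ ψ j (est + Real.logb 2 (1 / yr.2))

/-- Outer loop of `SampleEst`: `i` more rounds, `L` being the list of means so far. -/
noncomputable def sampleMeans {n m : ℕ} (φ : PropForm (Fin n ⊕ Fin m)) (ψ : PropForm (Fin m))
    (t : ℕ) : ℕ → List ℝ → OracleAlg n m (List ℝ)
  | 0, L => pure L
  | i + 1, L => do
      let est ← sampleSum φ ψ t 0
      sampleMeans φ ψ t i (L ++ [est / (t : ℝ)])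

/-- `SampleEst`, with the set sampled from given by the formula `ψ` over `V`. -/
noncomputable def sampleEst {n m : ℕ} (φ : PropForm (Fin n ⊕ Fin m)) (ψ : PropForm (Fin m))
    (t : ℕ) (δ : ℝ) : OracleAlg n m ℝ := do
  let L ← sampleMeans φ ψ t ⌈(9 / 2 : ℝ) * Real.logb 2 (2 / δ)⌉₊ []
  pure (listMedian L)

/-- Batch sizes are positive integers: a real prescription is rounded up, to at least `1`. -/
noncomputable def batch (x : ℝ) : ℕ := max 1 ⌈x⌉₊

/-- Batch size when an output of probability `r > 1/2` has been found. For `r = 1` the quotient is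
`n / 0 = 0`, which is also its limit as `r` tends to `1`. -/
noncomputable def batchHigh (n m : ℕ) (ε r : ℝ) : ℕ :=
  batch (6 / ε ^ 2 * min ((n : ℝ) / (2 * Real.logb 2 (1 / (1 - r))))
    ((m : ℝ) + Real.logb 2 ((m : ℝ) + Real.logb 2 (m : ℝ) + 2.5)))

/-- Batch size when no output of probability greater than `1/2` has been found. -/
noncomputable def batchLow (n m : ℕ) (ε : ℝ) : ℕ :=
  batch (6 / ε ^ 2 * (min (n : ℝ)
    ((m : ℝ) + Real.logb 2 ((m : ℝ) + Real.logb 2 (m : ℝ) + 1.1)) - 1))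

/-- Main loop with `i` rounds left, followed by the final estimate. -/
noncomputable def mainLoop {n m : ℕ} (φ : PropForm (Fin n ⊕ Fin m)) (ε δ : ℝ) :
    ℕ → OracleAlg n m ℝ
  | 0 => sampleEst φ (const true) (batchLow n m ε) (0.9 * δ)
  | i + 1 => do
      let xr ← proc φ (const true)
      if xr.2 > 1 / 2 then do
        let hrem ← sampleEst φ (neAssignment xr.1) (batchHigh n m ε xr.2) (0.9 * δ)
        pure ((1 - xr.2) * hrem + xr.2 * Real.logb 2 (1 / xr.2))
      else mainLoop φ ε δ i

/-- `EntropyEstimation(ε, δ)`, modified for circuit formulas. -/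
noncomputable def main {n m : ℕ} (φ : PropForm (Fin n ⊕ Fin m)) (ε δ : ℝ) : OracleAlg n m ℝ :=
  mainLoop φ ε δ ⌈Real.logb 2 (10 / δ)⌉₊

end EntropyEstimation

/-! For a circuit formula, projection to `U` is injective on solutions, so the denominator of `p_σ`
is the number of all solutions. Hence `p` is the law of the `V`-part of a uniform solution,
`PROC(S)` draws from `p` conditioned on `S`, and every nonzero `p_σ` is at least `1 / 2 ^ n`.
Entropy is the mean of `X = log (1 / p_σ)`, so the task is to estimate a mean within relative error
`ε`.

By Chebyshev, a batch of `6 b / ε ^ 2` samples fails with probability at most `1/6` if the variance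
is at most `b` times the squared mean. The median over the rounds turns `1/6` into the required
confidence. What remains is to bound the relative variance, which is dangerous only if the mean is
small, that is, if some output has probability above `1/2`. If there is none, then `X ≥ 1`
throughout. If there is one, `x` with probability `r`, each preliminary draw finds it with
probability above `1/2`; once found, its contribution to the entropy is known exactly, and on the
other outputs `X ≥ log (1 / (1 - r)) ≥ 1`.

Each variance bound has two versions (`condVar_const_true_le`, `condVar_neAssignment_le`). The
version in `n` uses `X ≤ n` and the Bhatia-Davis inequality. The version in `m` has no upper bound
on `X`; there `K = m + log D` serves as a soft one, since on `2 ^ m` points the outputs of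
information content above `K` contribute little to the mean of `(X - b) (X - K)`.

The failure budget is `0.9 δ` for the estimate and `0.1 δ` for missing a heavy output. -/

open scoped ENNReal

/-! ### Expectations and sure properties of oracle algorithms. -/

namespace OracleAlg

variable {n m : ℕ} {α β : Type} {junk : PropForm (Fin n ⊕ Fin m) → Fin n ⊕ Fin m → Bool}

/-- Expected value of `g` at the value returned by the algorithm. -/
noncomputable def expect (junk : PropForm (Fin n ⊕ Fin m) → Fin n ⊕ Fin m → Bool) :
    OracleAlg n m α → (α → ℝ≥0∞) → ℝ≥0∞
  | ret a, g => g a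
  | ask q k, g => ∑' ans, answer junk q ans * expect junk (k ans) g

theorem expect_pure (a : α) (g : α → ℝ≥0∞) :
    expect junk (pure a : OracleAlg n m α) g = g a := rfl

theorem expect_bind (A : OracleAlg n m α) (f : α → OracleAlg n m β) (g : β → ℝ≥0∞) :
    expect junk (A >>= f) g = expect junk A fun a => expect junk (f a) g := by
  change expect junk (seq A f) g = _
  induction A with
  | ret a => rfl
  | ask q k ih => simp only [seq, expect, ih]

theorem expect_mono (A : OracleAlg n m α) {f g : α → ℝ≥0∞} (h : ∀ a, f a ≤ g a) :
    expect junk A f ≤ expect junk A g := by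
  induction A with
  | ret a => exact h a
  | ask q k ih => exact ENNReal.tsum_le_tsum fun ans => mul_le_mul_right (ih ans) _

theorem expect_const (A : OracleAlg n m α) (c : ℝ≥0∞) :
    expect junk A (fun _ => c) = c := by
  induction A with
  | ret a => rfl
  | ask q k ih => simp only [expect, ih, ENNReal.tsum_mul_right, PMF.tsum_coe, one_mul]

theorem expect_add (A : OracleAlg n m α) (f g : α → ℝ≥0∞) :
    expect junk A (fun a => f a + g a) = expect junk A f + expect junk A g := by
  induction A with
  | ret a => rfl
  | ask q k ih => simp only [expect, ih, mul_add, ENNReal.tsum_add]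

theorem expect_const_mul (A : OracleAlg n m α) (c : ℝ≥0∞) (g : α → ℝ≥0∞) :
    expect junk A (fun a => c * g a) = c * expect junk A g := by
  induction A with
  | ret a => rfl
  | ask q k ih => simp only [expect, ih, ← ENNReal.tsum_mul_left, mul_left_comm]

/-- Links the recursive expectation, in which sequential composition is easy to handle, to the
distribution in the theorem. The query count is summed out. -/
theorem tsum_run_mul (A : OracleAlg n m α) (g : α → ℝ≥0∞) :
    ∑' ac, A.run junk ac * g ac.1 = expect junk A g := by
  induction A with
  | ret a =>
    rw [tsum_eq_single (a, 0)]
    · simp [run, expect]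
    · intro b hb
      simp [run, hb]
  | ask q k ih =>
    simp only [run, expect, ← ih, PMF.bind_apply, PMF.map_apply, ← ENNReal.tsum_mul_right]
    rw [ENNReal.tsum_comm]
    refine tsum_congr fun ans => ?_
    simp only [mul_assoc, ENNReal.tsum_mul_left]
    congr 1
    simp only [← ENNReal.tsum_mul_right]
    rw [ENNReal.tsum_comm]
    refine tsum_congr fun ac => ?_
    rw [tsum_eq_single (ac.1, ac.2 + 1)]
    · simp
    · intro b hb
      simp [hb]

/-- If the returned value lies outside `S` with probability at most `δ`, then it lies in `S` with
probability at least `1 - δ`. -/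
theorem le_run_toMeasure [MeasurableSpace α] (A : OracleAlg n m α) (S : Set α) {δ : ℝ}
    (h : expect junk A (Sᶜ.indicator 1) ≤ ENNReal.ofReal δ) (hδ : 0 ≤ δ) :
    ENNReal.ofReal (1 - δ) ≤ (A.run junk).toMeasure {hc : α × ℕ | hc.1 ∈ S} := by
  -- The outer measure is a lower bound for the measure of any set, so measurability of `S` is not
  -- needed.
  refine le_trans ?_ (PMF.toOuterMeasure_apply_le_toMeasure_apply _ _)
  have hS : (A.run junk).toOuterMeasure {hc : α × ℕ | hc.1 ∈ S}
      = expect junk A (S.indicator 1) := by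
    rw [PMF.toOuterMeasure_apply, ← tsum_run_mul]
    refine tsum_congr fun ac => ?_
    by_cases hac : ac.1 ∈ S <;> simp [Set.indicator, hac]
  have hsum : expect junk A (S.indicator 1) + expect junk A (Sᶜ.indicator 1) = 1 := by
    rw [← expect_add, ← expect_const (junk := junk) A 1]
    congr 1
    funext a
    by_cases ha : a ∈ S <;> simp [ha]
  rw [hS, ENNReal.ofReal_sub _ hδ, ENNReal.ofReal_one, ← hsum]
  exact tsub_le_iff_right.mpr (by gcongr)

/-- Every run satisfies `P`, a property of the returned value and of the number of queries. -/
def Always (junk : PropForm (Fin n ⊕ Fin m) → Fin n ⊕ Fin m → Bool) :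
    OracleAlg n m α → (α → ℕ → Prop) → Prop
  | ret a, P => P a 0
  | ask q k, P => ∀ ans ∈ (answer junk q).support, Always junk (k ans) fun a c => P a (c + 1)

theorem Always.of_mem_support {A : OracleAlg n m α} {P : α → ℕ → Prop} (h : Always junk A P) :
    ∀ ac ∈ (A.run junk).support, P ac.1 ac.2 := by
  induction A generalizing P with
  | ret a =>
    intro ac hac
    simp only [run, PMF.support_pure, Set.mem_singleton_iff] at hac
    subst hac
    exact h
  | ask q k ih =>
    intro ac hac
    simp only [run, PMF.mem_support_bind_iff, PMF.mem_support_map_iff] at hac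
    obtain ⟨ans, hans, bd, hbd, rfl⟩ := hac
    exact ih ans (h ans hans) bd hbd

theorem Always.mono {A : OracleAlg n m α} {P Q : α → ℕ → Prop} (h : Always junk A P)
    (hPQ : ∀ a c, P a c → Q a c) : Always junk A Q := by
  induction A generalizing P Q with
  | ret a => exact hPQ _ _ h
  | ask q k ih => exact fun ans hans => ih ans (h ans hans) fun a c => hPQ a (c + 1)

theorem Always.bind {A : OracleAlg n m α} {f : α → OracleAlg n m β} {P : β → ℕ → Prop}
    (h : Always junk A fun a c => Always junk (f a) fun b d => P b (c + d)) :
    Always junk (A >>= f) P := by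
  change Always junk (seq A f) P
  induction A generalizing P with
  | ret a => exact Always.mono h fun b d => by rw [Nat.zero_add]; exact id
  | ask q k ih =>
    refine fun ans hans => ih ans ((h ans hans).mono fun a c hac => hac.mono fun b d => ?_)
    rw [Nat.add_right_comm]
    exact id

end OracleAlg

/-! ### The output distribution of a circuit formula. -/

namespace PropForm

theorem eval_subst {X Y : Type} (f : X → PropForm Y) (τ : Y → Bool) (φ : PropForm X) :
    (φ.subst f).eval τ = φ.eval fun x => (f x).eval τ := by
  induction φ <;> simp_all [subst, eval]

theorem mem_sol {X : Type} [Fintype X] [DecidableEq X] {φ : PropForm X} {τ : X → Bool} :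
    τ ∈ φ.sol ↔ φ.eval τ = true := by
  simp [sol]

variable {n m : ℕ}

theorem eval_fixV (φ : PropForm (Fin n ⊕ Fin m)) (σ : Fin m → Bool) (τ : Fin n → Bool) :
    (φ.fixV σ).eval τ = φ.eval (Sum.elim τ σ) := by
  rw [fixV, eval_subst]
  congr 1
  funext x
  cases x <;> rfl

theorem eval_liftV (ψ : PropForm (Fin m)) (τ : Fin n ⊕ Fin m → Bool) :
    (liftV ψ : PropForm (Fin n ⊕ Fin m)).eval τ = ψ.eval fun v => τ (Sum.inr v) := by
  rw [liftV, eval_subst]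
  rfl

theorem sol_const_true : (const true : PropForm (Fin m)).sol = Finset.univ := by
  ext σ
  simp [mem_sol, eval]

theorem sol_neAssignment (x : Fin m → Bool) : (neAssignment x).sol = Finset.univ.erase x := by
  ext σ
  have h : ∀ l : List (Fin m),
      (l.foldr (fun v ψ => and (if x v then var v else neg (var v)) ψ) (const true)).eval σ = true
        ↔ ∀ v ∈ l, σ v = x v := by
    intro l
    induction l with
    | nil => simp [eval]
    | cons v l ih =>
      simp only [List.foldr_cons, eval, Bool.and_eq_true, ih, List.mem_cons, forall_eq_or_imp]
      refine and_congr_left fun _ => ?_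
      cases hx : x v <;> simp [eval]
  have h' := h (List.finRange m)
  have h'' : (∀ v ∈ List.finRange m, σ v = x v) ↔ σ = x := by simp [funext_iff]
  rw [h''] at h'
  rw [mem_sol, neAssignment, eval, Finset.mem_erase, ne_eq, ← h']
  simp

theorem card_sol_fixV (φ : PropForm (Fin n ⊕ Fin m)) (σ : Fin m → Bool) :
    (φ.fixV σ).sol.card = (φ.sol.filter fun τ => (fun v => τ (Sum.inr v)) = σ).card := by
  refine Finset.card_bij' (fun τ _ => Sum.elim τ σ) (fun τ _ u => τ (Sum.inl u)) ?_ ?_ ?_ ?_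
  · intro τ hτ
    rw [mem_sol, eval_fixV] at hτ
    simp [mem_sol, hτ]
  · intro τ hτ
    obtain ⟨hτ', rfl⟩ := Finset.mem_filter.mp hτ
    rw [mem_sol] at hτ' ⊢
    rw [eval_fixV, ← hτ']
    congr 1
    funext x
    cases x <;> rfl
  · intro τ _
    rfl
  · intro τ hτ
    obtain ⟨hτ, rfl⟩ := Finset.mem_filter.mp hτ
    funext x
    cases x <;> rfl

/-- The circuit property says exactly that restriction to `U` is injective on solutions. This is
what makes `outProb` a probability distribution. -/
theorem IsCircuit.card_projSol {φ : PropForm (Fin n ⊕ Fin m)} (hφ : φ.IsCircuit) :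
    (φ.projSol (blockU n m)).card = φ.sol.card := by
  refine Finset.card_image_of_injOn fun τ₁ h₁ τ₂ h₂ h => hφ τ₁ h₁ τ₂ h₂ fun u => ?_
  exact congrFun h ⟨Sum.inl u, by simp [blockU]⟩

theorem card_projSol_pos {φ : PropForm (Fin n ⊕ Fin m)} (hφ : φ.sol.Nonempty) :
    0 < (φ.projSol (blockU n m)).card :=
  Finset.card_pos.mpr (hφ.image _)

theorem card_projSol_le (φ : PropForm (Fin n ⊕ Fin m)) :
    (φ.projSol (blockU n m)).card ≤ 2 ^ n := by
  refine (Finset.card_le_univ _).trans_eq ?_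
  rw [Fintype.card_fun, Fintype.card_bool, Fintype.card_coe, blockU, Finset.card_map,
    Finset.card_univ, Fintype.card_fin]

theorem outProb_nonneg (φ : PropForm (Fin n ⊕ Fin m)) (σ : Fin m → Bool) : 0 ≤ φ.outProb σ := by
  unfold outProb
  positivity

theorem one_div_two_pow_le_outProb {φ : PropForm (Fin n ⊕ Fin m)} (hφ : φ.sol.Nonempty)
    {σ : Fin m → Bool} (hσ : φ.outProb σ ≠ 0) : 1 / (2 : ℝ) ^ n ≤ φ.outProb σ := by
  have hN : (0 : ℝ) < (φ.projSol (blockU n m)).card := by exact_mod_cast card_projSol_pos hφ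
  have h1 : (1 : ℝ) ≤ (φ.fixV σ).sol.card := by
    rw [Nat.one_le_cast, Nat.one_le_iff_ne_zero]
    rintro h0
    exact hσ (by simp [outProb, h0])
  have h2 : ((φ.projSol (blockU n m)).card : ℝ) ≤ 2 ^ n := by exact_mod_cast card_projSol_le φ
  unfold outProb
  gcongr

/-- Averaging over the solutions of a circuit formula whose output lies in `sol ψ`. -/
theorem sum_outProb_mul {φ : PropForm (Fin n ⊕ Fin m)} (hφ : φ.IsCircuit) (hs : φ.sol.Nonempty)
    (ψ : PropForm (Fin m)) (F : (Fin m → Bool) → ℝ) :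
    ∑ τ ∈ (and φ (liftV ψ)).sol, F (fun v => τ (Sum.inr v))
      = (φ.sol.card : ℝ) * ∑ σ ∈ ψ.sol, φ.outProb σ * F σ := by
  have hN : (φ.sol.card : ℝ) ≠ 0 := by exact_mod_cast (Finset.card_pos.mpr hs).ne'
  have hsol : (and φ (liftV ψ)).sol = φ.sol.filter fun τ => (fun v => τ (Sum.inr v)) ∈ ψ.sol := by
    ext τ
    simp [mem_sol, eval, eval_liftV]
  -- Group the solutions by their `V`-part; the fibre over `σ` has `|sol φ| * p_σ` elements.
  rw [hsol, Finset.mul_sum, ← Finset.sum_fiberwise_of_maps_to (t := ψ.sol)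
    (g := fun (τ : Fin n ⊕ Fin m → Bool) (v : Fin m) => τ (Sum.inr v)) fun τ hτ => (Finset.mem_filter.mp hτ).2]
  refine Finset.sum_congr rfl fun σ hσ => ?_
  rw [outProb, hφ.card_projSol, card_sol_fixV, ← mul_assoc, mul_div_cancel₀ _ hN,
    Finset.filter_filter]
  have hfil : (φ.sol.filter fun τ => (fun v => τ (Sum.inr v)) ∈ ψ.sol ∧
      (fun v => τ (Sum.inr v)) = σ) = φ.sol.filter fun τ => (fun v => τ (Sum.inr v)) = σ := by
    refine Finset.filter_congr fun τ _ => ⟨fun h => h.2, fun h => ⟨h ▸ hσ, h⟩⟩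
  rw [hfil, Finset.sum_congr rfl fun τ hτ => by rw [(Finset.mem_filter.mp hτ).2],
    Finset.sum_const, nsmul_eq_mul]

theorem card_sol_and_liftV {φ : PropForm (Fin n ⊕ Fin m)} (hφ : φ.IsCircuit)
    (hs : φ.sol.Nonempty) (ψ : PropForm (Fin m)) :
    ((and φ (liftV ψ)).sol.card : ℝ) = φ.sol.card * ∑ σ ∈ ψ.sol, φ.outProb σ := by
  simpa using sum_outProb_mul hφ hs ψ fun _ => 1

theorem sum_outProb {φ : PropForm (Fin n ⊕ Fin m)} (hφ : φ.IsCircuit) (hs : φ.sol.Nonempty) :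
    ∑ σ, φ.outProb σ = 1 := by
  have h := card_sol_and_liftV hφ hs (const true)
  have hN : (φ.sol.card : ℝ) ≠ 0 := by exact_mod_cast (Finset.card_pos.mpr hs).ne'
  have hsol : (and φ (liftV (const true))).sol = φ.sol := by
    ext τ
    simp [mem_sol, eval, eval_liftV]
  rw [hsol, sol_const_true] at h
  exact mul_left_cancel₀ hN (by rw [← h, mul_one])

theorem outProb_le_one {φ : PropForm (Fin n ⊕ Fin m)} (hφ : φ.IsCircuit) (hs : φ.sol.Nonempty)
    (σ : Fin m → Bool) : φ.outProb σ ≤ 1 := by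
  rw [← sum_outProb hφ hs]
  exact Finset.single_le_sum (fun σ _ => φ.outProb_nonneg σ) (Finset.mem_univ σ)

end PropForm

/-! ### The law of a `PROC` call. -/

namespace EntropyEstimation

open PropForm OracleAlg

variable {n m : ℕ} {φ : PropForm (Fin n ⊕ Fin m)}
  {junk : PropForm (Fin n ⊕ Fin m) → Fin n ⊕ Fin m → Bool}

/-- `PROC(S)` draws from the output distribution conditioned on `S`. -/
theorem expect_proc (hφ : φ.IsCircuit) (hs : φ.sol.Nonempty) (ψ : PropForm (Fin m))
    (hψ : 0 < ∑ σ ∈ ψ.sol, φ.outProb σ) (g : (Fin m → Bool) × ℝ → ℝ) (hg : ∀ x, 0 ≤ g x) :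
    expect junk (proc φ ψ) (fun x => ENNReal.ofReal (g x))
      = ENNReal.ofReal (∑ σ ∈ ψ.sol, φ.outProb σ / (∑ σ ∈ ψ.sol, φ.outProb σ)
          * g (σ, φ.outProb σ)) := by
  have hN : (0 : ℝ) < φ.sol.card := by exact_mod_cast Finset.card_pos.mpr hs
  have hS := card_sol_and_liftV hφ hs ψ
  have hSpos : (0 : ℝ) < (and φ (liftV ψ)).sol.card := by rw [hS]; positivity
  have hne : (and φ (liftV ψ)).sol.Nonempty := Finset.card_pos.mp (by exact_mod_cast hSpos)
  have key : expect junk (proc φ ψ) (fun x => ENNReal.ofReal (g x))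
      = ∑' τ, PMF.uniformOfFinset (and φ (liftV ψ)).sol hne τ *
          ENNReal.ofReal (g (fun v => τ (Sum.inr v), φ.outProb fun v => τ (Sum.inr v))) := by
    have hc : ∀ (χ : PropForm (Fin n)) (h : ℕ → ℝ≥0∞),
        ∑' a, (answer junk (OracleQuery.count χ : OracleQuery n m)) a * h a = h χ.sol.card := by
      intro χ h
      rw [tsum_eq_single χ.sol.card]
      · simp [answer]
      · intro b hb
        simp [answer, hb]
    have hp : ∀ (χ : PropForm (Fin n ⊕ Fin m)) P (h : ℕ → ℝ≥0∞),
        ∑' a, (answer junk (OracleQuery.projCount χ P : OracleQuery n m)) a * h a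
          = h (χ.projSol P).card := by
      intro χ P h
      rw [tsum_eq_single (χ.projSol P).card]
      · simp [answer]
      · intro b hb
        simp [answer, hb]
    rw [proc, expect_bind]
    simp only [expect_bind, OracleAlg.sample, OracleAlg.count, OracleAlg.projCount, expect,
      expect_pure, hc, hp]
    simp only [answer, dif_pos hne]
    rfl
  rw [key, tsum_fintype]
  simp only [PMF.uniformOfFinset_apply, ite_mul, zero_mul]
  rw [Finset.sum_ite_mem, Finset.univ_inter, ← Finset.mul_sum,
    ← ENNReal.ofReal_sum_of_nonneg fun _ _ => hg _,
    sum_outProb_mul hφ hs ψ fun σ => g (σ, φ.outProb σ), ← ENNReal.ofReal_natCast,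
    ← ENNReal.ofReal_inv_of_pos hSpos, ← ENNReal.ofReal_mul (by positivity), hS]
  congr 1
  simp only [div_mul_eq_mul_div, ← Finset.sum_div]
  field_simp

/-- The second component returned is always the exact probability of the first, even if the sampler
answers arbitrarily, so a comparison is needed only on such pairs. -/
theorem expect_proc_mono {ψ : PropForm (Fin m)} {f g : (Fin m → Bool) × ℝ → ℝ≥0∞}
    (h : ∀ xr, xr.2 = φ.outProb xr.1 → f xr ≤ g xr) :
    expect junk (proc φ ψ) f ≤ expect junk (proc φ ψ) g := by
  refine ENNReal.tsum_le_tsum fun τ => mul_le_mul_right ?_ _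
  have hc : ∀ a, answer junk (OracleQuery.count (φ.fixV fun v => τ (Sum.inr v)) :
      OracleQuery n m) a = if a = (φ.fixV fun v => τ (Sum.inr v)).sol.card then 1 else 0 :=
    fun a => (PMF.pure_apply _ _).trans (by congr)
  have hp : ∀ b, answer junk (OracleQuery.projCount φ (blockU n m)) b
      = if b = (φ.projSol (blockU n m)).card then 1 else 0 := fun b =>
      (PMF.pure_apply _ _).trans (by congr)
  refine ENNReal.tsum_le_tsum fun a => ?_
  rw [hc]
  split_ifs with ha
  · refine mul_le_mul_right (ENNReal.tsum_le_tsum fun b => ?_) _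
    rw [hp]
    split_ifs with hb
    · subst ha hb
      exact mul_le_mul_right (h _ rfl) _
    · simp
  · simp

theorem always_proc {ψ : PropForm (Fin m)} {P : (Fin m → Bool) × ℝ → ℕ → Prop}
    (h : ∀ σ, P (σ, φ.outProb σ) 3) : Always junk (proc φ ψ) P := by
  unfold proc
  refine fun τ _ => fun a ha => fun b hb => ?_
  have ha' : a = (φ.fixV fun v => τ (Sum.inr v)).sol.card := by
    simpa [answer] using ha
  have hb' : b = (φ.projSol (blockU n m)).card := by
    simpa [answer] using hb
  subst ha' hb'
  exact h _

end EntropyEstimation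

/-! ### Medians and the number of rounds. -/

/-- If fewer than half of the entries lie outside `[a, b]`, then the median lies in `[a, b]`. -/
theorem listMedian_mem_Icc {L : List ℝ} {a b : ℝ}
    (h : 2 * L.countP (fun x => decide (x ∉ Set.Icc a b)) < L.length) :
    listMedian L ∈ Set.Icc a b := by
  set S := L.insertionSort (· ≤ ·) with hS
  have hperm : S.Perm L := List.perm_insertionSort _ L
  have hlen : S.length = L.length := hperm.length_eq
  have hsorted : S.Pairwise (· ≤ ·) := List.pairwise_insertionSort _ L
  rw [← hperm.countP_eq] at h
  -- For a middle index `k`, both the first `k + 1` and the last `L.length - k` sorted entries make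
  -- up at least half of the list. If entry `k` is below `a`, the former are all bad; if it is above
  -- `b`, the latter are.
  have key : ∀ k, L.length ≤ 2 * (k + 1) → L.length ≤ 2 * (L.length - k) → k < L.length →
      S.getD k 0 ∈ Set.Icc a b := by
    intro k h1 h2 hk
    have hk' : k < S.length := by omega
    have hget : S.getD k 0 = S[k] := by simp [List.getD, hk']
    rw [hget]
    rw [List.pairwise_iff_getElem] at hsorted
    constructor
    · by_contra! hlt
      have hall : ∀ x ∈ S.take (k + 1), decide (x ∉ Set.Icc a b) = true := by
        intro x hx
        obtain ⟨i, hi, rfl⟩ := List.mem_iff_getElem.mp hx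
        rw [List.length_take] at hi
        have hle : S[i]'(by omega) ≤ S[k] := by
          rcases Nat.lt_or_ge i k with hik | hik
          · exact hsorted i k _ _ hik
          · have : i = k := by omega
            subst this
            rfl
        simp only [List.getElem_take, decide_eq_true_eq, Set.mem_Icc, not_and_or, not_le]
        exact Or.inl (hle.trans_lt hlt)
      have hc := List.countP_eq_length.mpr hall
      have hsub := (List.take_sublist (k + 1) S).countP_le (p := fun x => decide (x ∉ Set.Icc a b))
      rw [hc, List.length_take] at hsub
      omega
    · by_contra! hlt
      have hall : ∀ x ∈ S.drop k, decide (x ∉ Set.Icc a b) = true := by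
        intro x hx
        obtain ⟨i, hi, rfl⟩ := List.mem_iff_getElem.mp hx
        rw [List.length_drop] at hi
        have hle : S[k] ≤ S[k + i]'(by omega) := by
          rcases Nat.eq_zero_or_pos i with hik | hik
          · subst hik
            rfl
          · exact hsorted k (k + i) _ _ (by omega)
        simp only [List.getElem_drop, decide_eq_true_eq, Set.mem_Icc, not_and_or, not_le]
        exact Or.inr (hlt.trans_le hle)
      have hc := List.countP_eq_length.mpr hall
      have hsub := (List.drop_sublist k S).countP_le (p := fun x => decide (x ∉ Set.Icc a b))
      rw [hc, List.length_drop] at hsub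
      omega
  have h1 := key ((L.length - 1) / 2) (by omega) (by omega) (by omega)
  have h2 := key (L.length / 2) (by omega) (by omega) (by omega)
  rw [listMedian, ← hS]
  constructor
  · linarith [h1.1, h2.1]
  · linarith [h1.2, h2.2]

/-- Number of rounds after which the median fails with probability at most `δ`. -/
theorem three_quarters_pow_le {δ : ℝ} (h0 : 0 < δ) (h2 : δ ≤ 2) :
    (3 / 4 : ℝ) ^ ⌈(9 / 2 : ℝ) * Real.logb 2 (2 / δ)⌉₊ ≤ δ := by
  set x := Real.logb 2 (2 / δ) with hx
  have hx0 : 0 ≤ x := Real.logb_nonneg one_lt_two (by rw [le_div_iff₀ h0]; linarith)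
  have hT := Nat.le_ceil ((9 / 2 : ℝ) * x)
  have hpow : (2 : ℝ) ^ (-x) = δ / 2 := by
    rw [Real.rpow_neg zero_le_two, hx, Real.rpow_logb two_pos (by norm_num) (by positivity),
      inv_div]
  rw [← Real.rpow_natCast]
  calc (3 / 4 : ℝ) ^ (⌈(9 / 2 : ℝ) * x⌉₊ : ℝ)
      ≤ (3 / 4 : ℝ) ^ ((3 : ℕ) * x) :=
        Real.rpow_le_rpow_of_exponent_ge (by norm_num) (by norm_num) (by push_cast; linarith)
    _ = (27 / 64 : ℝ) ^ x := by
        rw [Real.rpow_mul (by norm_num), Real.rpow_natCast]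
        norm_num
    _ ≤ (1 / 2 : ℝ) ^ x := Real.rpow_le_rpow (by norm_num) (by norm_num) hx0
    _ = δ / 2 := by rw [← hpow, Real.rpow_neg zero_le_two, one_div, Real.inv_rpow zero_le_two]
    _ ≤ δ := by linarith

/-! ### Failure probability of a batch and of the median of batches. -/

namespace EntropyEstimation

open PropForm OracleAlg

variable {n m : ℕ} {φ : PropForm (Fin n ⊕ Fin m)} {ψ : PropForm (Fin m)}
  {junk : PropForm (Fin n ⊕ Fin m) → Fin n ⊕ Fin m → Bool}

/-- Conditional probability of `σ` given `sol ψ`. -/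
noncomputable def condProb (φ : PropForm (Fin n ⊕ Fin m)) (ψ : PropForm (Fin m))
    (σ : Fin m → Bool) : ℝ :=
  φ.outProb σ / ∑ σ ∈ ψ.sol, φ.outProb σ

/-- Conditional mean of `log (1 / p_σ)` given `sol ψ`. -/
noncomputable def condMean (φ : PropForm (Fin n ⊕ Fin m)) (ψ : PropForm (Fin m)) : ℝ :=
  ∑ σ ∈ ψ.sol, condProb φ ψ σ * Real.logb 2 (1 / φ.outProb σ)

/-- Conditional variance of `log (1 / p_σ)` given `sol ψ`. -/
noncomputable def condVar (φ : PropForm (Fin n ⊕ Fin m)) (ψ : PropForm (Fin m)) : ℝ :=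
  ∑ σ ∈ ψ.sol, condProb φ ψ σ * (Real.logb 2 (1 / φ.outProb σ) - condMean φ ψ) ^ 2

theorem condProb_nonneg (φ : PropForm (Fin n ⊕ Fin m)) (ψ : PropForm (Fin m))
    (σ : Fin m → Bool) : 0 ≤ condProb φ ψ σ :=
  div_nonneg (φ.outProb_nonneg σ) (Finset.sum_nonneg fun σ _ => φ.outProb_nonneg σ)

theorem sum_condProb (hψ : 0 < ∑ σ ∈ ψ.sol, φ.outProb σ) :
    ∑ σ ∈ ψ.sol, condProb φ ψ σ = 1 := by
  simp only [condProb, ← Finset.sum_div]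
  exact div_self hψ.ne'

theorem condVar_nonneg (φ : PropForm (Fin n ⊕ Fin m)) (ψ : PropForm (Fin m)) :
    0 ≤ condVar φ ψ :=
  Finset.sum_nonneg fun σ _ => mul_nonneg (condProb_nonneg φ ψ σ) (sq_nonneg _)

/-- Variance plus squared bias of a sum of `j` independent samples started at `s`. Keeping `s`
general lets the induction replace any appeal to independence. -/
theorem expect_sampleSum_sq (hφ : φ.IsCircuit) (hs : φ.sol.Nonempty)
    (hψ : 0 < ∑ σ ∈ ψ.sol, φ.outProb σ) (a : ℝ) (j : ℕ) (s : ℝ) :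
    expect junk (sampleSum φ ψ j s) (fun y => ENNReal.ofReal ((y - a) ^ 2))
      = ENNReal.ofReal (j * condVar φ ψ + (s + j * condMean φ ψ - a) ^ 2) := by
  induction j generalizing s with
  | zero => simp [sampleSum, expect_pure]
  | succ j ih =>
    rw [sampleSum, expect_bind]
    simp only [ih]
    rw [expect_proc hφ hs ψ hψ (fun x => j * condVar φ ψ +
      (s + Real.logb 2 (1 / x.2) + j * condMean φ ψ - a) ^ 2)
      fun x => add_nonneg (mul_nonneg j.cast_nonneg (condVar_nonneg φ ψ)) (sq_nonneg _)]
    congr 1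
    set E := condMean φ ψ with hE
    set V := condVar φ ψ with hV
    -- The deviation inside the square is `(X - E) + c`, and the cross term averages to zero.
    set c : ℝ := s + (j + 1) * E - a with hc
    have hsum : ∀ σ, condProb φ ψ σ * (j * V + (s + Real.logb 2 (1 / φ.outProb σ) + j * E - a) ^ 2)
        = (j * V + c ^ 2 - 2 * c * E) * condProb φ ψ σ
          + 2 * c * (condProb φ ψ σ * Real.logb 2 (1 / φ.outProb σ))
          + condProb φ ψ σ * (Real.logb 2 (1 / φ.outProb σ) - E) ^ 2 := by
      intro σ
      rw [hc]
      ring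
    have hcond : ∀ σ, φ.outProb σ / (∑ σ ∈ ψ.sol, φ.outProb σ) = condProb φ ψ σ := fun σ => rfl
    simp only [hcond, hsum]
    rw [Finset.sum_add_distrib, Finset.sum_add_distrib, ← Finset.mul_sum, ← Finset.mul_sum,
      sum_condProb hψ, ← condMean, ← hE, hE, ← condVar, ← hE, ← hV]
    push_cast
    ring

/-- Chebyshev's inequality for the mean of a batch. -/
theorem expect_sampleSum_fail_le (hφ : φ.IsCircuit) (hs : φ.sol.Nonempty)
    (hψ : 0 < ∑ σ ∈ ψ.sol, φ.outProb σ) {ε b : ℝ} (hε : 0 < ε) {t : ℕ} (ht0 : 0 < t)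
    (hE : 0 < condMean φ ψ) (ht : 6 / ε ^ 2 * b ≤ t)
    (hV : condVar φ ψ ≤ b * condMean φ ψ ^ 2) :
    expect junk (sampleSum φ ψ t 0) (fun y => (Set.Icc ((1 - ε) * condMean φ ψ)
      ((1 + ε) * condMean φ ψ))ᶜ.indicator 1 (y / t)) ≤ ENNReal.ofReal (1 / 6) := by
  set E := condMean φ ψ
  set V := condVar φ ψ
  have ht0' : (0 : ℝ) < t := by exact_mod_cast ht0
  have hc : 0 < (t * (ε * E)) ^ 2 := by positivity
  -- A bad mean puts the sum at distance at least `t * (ε * E)` from its expectation, so the squared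
  -- deviation, suitably scaled, dominates the indicator. The resulting bound is `V / (t * ε ^ 2 * E
  -- ^ 2)`.
  have hpt : ∀ y : ℝ, (Set.Icc ((1 - ε) * E) ((1 + ε) * E))ᶜ.indicator 1 (y / t)
      ≤ ENNReal.ofReal (1 / (t * (ε * E)) ^ 2) * ENNReal.ofReal ((y - t * E) ^ 2) := by
    intro y
    by_cases hy : y / t ∈ Set.Icc ((1 - ε) * E) ((1 + ε) * E)
    · simp [hy]
    · rw [Set.indicator_of_mem (by exact hy), ← ENNReal.ofReal_mul (by positivity), Pi.one_apply,
        ← ENNReal.ofReal_one]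
      apply ENNReal.ofReal_le_ofReal
      rw [one_div, inv_mul_eq_div, le_div_iff₀ hc, one_mul]
      have hd : 0 ≤ t * (ε * E) := by positivity
      rw [Set.mem_Icc, not_and_or, not_le, not_le, div_lt_iff₀ ht0', lt_div_iff₀ ht0'] at hy
      rcases hy with hy | hy
      · rw [← neg_sq (y - t * E)]
        exact pow_le_pow_left₀ hd (by linarith) 2
      · exact pow_le_pow_left₀ hd (by linarith) 2
  refine (expect_mono _ hpt).trans ?_
  rw [expect_const_mul, expect_sampleSum_sq hφ hs hψ, ← ENNReal.ofReal_mul (by positivity)]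
  apply ENNReal.ofReal_le_ofReal
  rw [one_div, inv_mul_eq_div, div_le_iff₀ hc]
  have h1 : 6 * b ≤ t * ε ^ 2 := by
    rwa [div_mul_eq_mul_div, div_le_iff₀ (by positivity)] at ht
  have h2 : 6 * V ≤ t * ε ^ 2 * E ^ 2 := by nlinarith [sq_nonneg E]
  have h3 : 0 ≤ t * (t * ε ^ 2 * E ^ 2 - 6 * V) := mul_nonneg ht0'.le (by linarith)
  nlinarith

/-- Exponential Markov inequality with weight `4 ^ bad / 2 ^ length`, which is at least `1` when
half of the entries are bad. A bad round doubles it and a good one halves it, so the expected factor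
per round is at most `1/2 + 3/2 * 1/6 = 3/4`. -/
theorem expect_sampleMeans_le {B : Set ℝ} [DecidablePred (· ∈ B)] {t : ℕ}
    (hB : expect junk (sampleSum φ ψ t 0) (fun y => B.indicator 1 (y / t))
      ≤ ENNReal.ofReal (1 / 6)) (i : ℕ) (L : List ℝ) :
    expect junk (sampleMeans φ ψ t i L)
      (fun L => if L.length ≤ 2 * L.countP (fun x => decide (x ∈ B)) then 1 else 0)
      ≤ ENNReal.ofReal ((3 / 4) ^ i *
        (4 ^ L.countP (fun x => decide (x ∈ B)) / 2 ^ L.length)) := by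
  induction i generalizing L with
  | zero =>
    rw [sampleMeans, expect_pure]
    split_ifs with h
    · rw [← ENNReal.ofReal_one]
      apply ENNReal.ofReal_le_ofReal
      rw [pow_zero, one_mul, le_div_iff₀ (by positivity), one_mul]
      calc (2 : ℝ) ^ L.length ≤ 2 ^ (2 * L.countP (fun x => decide (x ∈ B))) :=
            pow_le_pow_right₀ one_le_two h
        _ = _ := by rw [pow_mul]; norm_num
    · exact zero_le
  | succ i ih =>
    rw [sampleMeans, expect_bind]
    set c := L.countP (fun x => decide (x ∈ B)) with hc
    have hstep : ∀ y : ℝ, expect junk (sampleMeans φ ψ t i (L ++ [y / t]))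
        (fun L => if L.length ≤ 2 * L.countP (fun x => decide (x ∈ B)) then 1 else 0)
        ≤ ENNReal.ofReal ((3 / 4) ^ i * (4 ^ c / 2 ^ L.length)) *
          (ENNReal.ofReal (1 / 2) + ENNReal.ofReal (3 / 2) * B.indicator 1 (y / t)) := by
      intro y
      refine (ih _).trans_eq ?_
      by_cases hy : y / t ∈ B
      · rw [Set.indicator_of_mem hy, Pi.one_apply, mul_one,
          ← ENNReal.ofReal_add (by norm_num) (by norm_num), ← ENNReal.ofReal_mul (by positivity)]
        congr 1
        simp only [List.countP_append, List.length_append, List.countP_singleton, hy, ← hc,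
          List.length_singleton, pow_succ, decide_true, if_true]
        field_simp
        norm_num
      · rw [Set.indicator_of_notMem hy, mul_zero, add_zero, ← ENNReal.ofReal_mul (by positivity)]
        congr 1
        simp only [List.countP_append, List.length_append, List.countP_singleton, hy, ← hc,
          List.length_singleton, pow_succ, decide_false]
        simp
        field_simp
    refine (expect_mono _ hstep).trans ?_
    rw [expect_const_mul, expect_add, expect_const, expect_const_mul]
    calc _ ≤ ENNReal.ofReal ((3 / 4) ^ i * (4 ^ c / 2 ^ L.length)) *
          (ENNReal.ofReal (1 / 2) + ENNReal.ofReal (3 / 2) * ENNReal.ofReal (1 / 6)) := by gcongr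
      _ = _ := by
        rw [← ENNReal.ofReal_mul (by norm_num), ← ENNReal.ofReal_add (by norm_num) (by norm_num),
          ← ENNReal.ofReal_mul (by positivity)]
        congr 1
        ring

/-- The median trick. -/
theorem expect_sampleEst_fail_le {a b δ : ℝ} {t : ℕ} (h0 : 0 < δ) (h2 : δ ≤ 2)
    (h : expect junk (sampleSum φ ψ t 0) (fun y => (Set.Icc a b)ᶜ.indicator 1 (y / t))
      ≤ ENNReal.ofReal (1 / 6)) :
    expect junk (sampleEst φ ψ t δ) ((Set.Icc a b)ᶜ.indicator 1) ≤ ENNReal.ofReal δ := by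
  classical
  rw [sampleEst, expect_bind]
  refine (expect_mono _ (g := fun L => if L.length ≤ 2 * L.countP
    (fun x => decide (x ∈ (Set.Icc a b)ᶜ)) then 1 else 0) fun L => ?_).trans
    ((expect_sampleMeans_le h _ []).trans (ENNReal.ofReal_le_ofReal ?_))
  · rw [expect_pure]
    split_ifs with hL
    · exact Set.indicator_le_self' (fun _ _ => zero_le) _
    · rw [Set.indicator_of_notMem]
      rw [Set.notMem_compl_iff]
      apply listMedian_mem_Icc
      refine lt_of_eq_of_lt ?_ (not_le.mp hL)
      congr! 3
  · simpa using three_quarters_pow_le h0 h2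

end EntropyEstimation

/-! ### Moments of information content. -/

/-- The left side is nonpositive unless the information content is `K + s` with `s > 0`. Then `q = 2
^ (-K) * 2 ^ (-s)`, and the exponential beats the quadratic growth: `s * 2 ^ (-s) ≤ 1` and `s ^ 2 *
2 ^ (-s) ≤ 4`. -/
theorem mul_log_sub_mul_log_sub_le {q b K : ℝ} (hq : 0 ≤ q) (hb : 0 ≤ b) (hbK : b ≤ K)
    (hY : 0 < q → b ≤ Real.logb 2 (1 / q)) :
    q * ((Real.logb 2 (1 / q) - b) * (Real.logb 2 (1 / q) - K)) ≤ 2 ^ (-K) * (K + 4) := by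
  have hpos : (0 : ℝ) ≤ 2 ^ (-K) * (K + 4) := by
    have := Real.rpow_pos_of_pos (zero_lt_two (α := ℝ)) (-K)
    have : 0 ≤ K + 4 := by linarith
    positivity
  rcases hq.eq_or_lt with rfl | hq
  · simpa using hpos
  specialize hY hq
  set Y := Real.logb 2 (1 / q) with hYdef
  rcases le_or_gt Y K with h | h
  · refine le_trans ?_ hpos
    nlinarith [mul_nonneg hq.le (mul_nonneg (sub_nonneg.mpr hY) (sub_nonneg.mpr h))]
  · set s := Y - K with hs
    have hs0 : 0 < s := sub_pos.mpr h
    have hqeq : q = 2 ^ (-K) * 2 ^ (-s) := by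
      rw [← Real.rpow_add two_pos, hs, show -K + -(Y - K) = -Y by ring, Real.rpow_neg two_pos.le,
        hYdef, Real.rpow_logb two_pos (by norm_num) (by positivity), one_div, inv_inv]
    have hlin : ∀ u : ℝ, 0 ≤ u → u * 2 ^ (-u) ≤ 1 := by
      intro u hu
      rw [Real.rpow_neg two_pos.le, ← div_eq_mul_inv, div_le_one (by positivity)]
      have h1 := one_add_mul_self_le_rpow_one_add (s := 1) (by norm_num) (p := max u 1)
        (le_max_right _ _)
      rcases le_total u 1 with h1' | h1'
      · exact h1'.trans (Real.one_le_rpow one_le_two hu)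
      · rw [max_eq_left h1'] at h1
        norm_num at h1
        linarith
    have hsq : s ^ 2 * 2 ^ (-s) ≤ 4 := by
      have h1 := hlin (s / 2) (by positivity)
      have h2 : (2 : ℝ) ^ (-s) = 2 ^ (-(s / 2)) * 2 ^ (-(s / 2)) := by
        rw [← Real.rpow_add two_pos]
        congr 1
        ring
      have h3 : 0 ≤ s / 2 * (2 : ℝ) ^ (-(s / 2)) := by positivity
      rw [h2]
      nlinarith
    have hYs : Y - b ≤ K + s := by rw [hs]; linarith
    calc q * ((Y - b) * s) ≤ q * ((K + s) * s) := by gcongr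
      _ = 2 ^ (-K) * (K * (s * 2 ^ (-s)) + s ^ 2 * 2 ^ (-s)) := by
        rw [hqeq]
        ring
      _ ≤ 2 ^ (-K) * (K * 1 + 4) := by
        have := hlin s hs0.le
        have : 0 ≤ K := hb.trans hbK
        gcongr
      _ = _ := by rw [mul_one]

theorem two_le_logb_four {D : ℝ} (hD : 4 ≤ D) : 2 ≤ Real.logb 2 D := by
  rw [Real.le_logb_iff_rpow_le one_lt_two (by linarith)]
  norm_num
  exact hD

section Moments

variable {ι : Type*} {A : Finset ι} {q X : ι → ℝ}

/-- A distribution on at most `2 ^ m` points has `E[(Y - b) (Y - K)] ≤ K - 1`, where `Y` is the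
information content. -/
theorem sum_mul_log_sub_mul_log_sub_le {m : ℕ} (hm : 2 ≤ m) (hA : A.card ≤ 2 ^ m)
    (hq : ∀ i ∈ A, 0 ≤ q i) {D b : ℝ} (hD : 4 ≤ D) (hb0 : 0 ≤ b) (hb1 : b ≤ 1)
    (hY : ∀ i ∈ A, 0 < q i → b ≤ Real.logb 2 (1 / q i)) :
    ∑ i ∈ A, q i * ((Real.logb 2 (1 / q i) - b) *
        (Real.logb 2 (1 / q i) - (m + Real.logb 2 D)))
      ≤ m + Real.logb 2 D - 1 := by
  set K : ℝ := m + Real.logb 2 D with hK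
  have hm' : (2 : ℝ) ≤ m := by exact_mod_cast hm
  have hK4 : 4 ≤ K := by linarith [two_le_logb_four hD]
  have hpow : (2 : ℝ) ^ m * 2 ^ (-K) = D⁻¹ := by
    rw [← Real.rpow_natCast, ← Real.rpow_add two_pos, hK,
      show (m : ℝ) + -(m + Real.logb 2 D) = -Real.logb 2 D by ring, Real.rpow_neg two_pos.le,
      Real.rpow_logb two_pos (by norm_num) (by linarith)]
  have hc : (A.card : ℝ) ≤ 2 ^ m := by exact_mod_cast hA
  calc _ ≤ ∑ i ∈ A, (2 : ℝ) ^ (-K) * (K + 4) := Finset.sum_le_sum fun i hi =>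
        mul_log_sub_mul_log_sub_le (hq i hi) hb0 (by linarith) (hY i hi)
    _ = A.card * 2 ^ (-K) * (K + 4) := by rw [Finset.sum_const, nsmul_eq_mul, mul_assoc]
    _ ≤ 2 ^ m * 2 ^ (-K) * (K + 4) := by
        have : 0 ≤ K + 4 := by linarith
        gcongr
    _ = D⁻¹ * (K + 4) := by rw [hpow]
    _ ≤ 4⁻¹ * (K + 4) := by
        have : 0 ≤ K + 4 := by linarith
        gcongr
    -- Any `K ≥ 8 / 3` would do here.
    _ ≤ K - 1 := by linarith

/-- Turns a bound on the mean of `(X - b) (X - K)` into a bound on the variance. -/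
theorem sum_mul_sub_mul_sub (hq1 : ∑ i ∈ A, q i = 1) (b K : ℝ) :
    ∑ i ∈ A, q i * ((X i - b) * (X i - K))
      = ∑ i ∈ A, q i * (X i - ∑ i ∈ A, q i * X i) ^ 2
        + (∑ i ∈ A, q i * X i - b) * (∑ i ∈ A, q i * X i - K) := by
  set E := ∑ i ∈ A, q i * X i with hE
  have h1 : ∀ i, q i * ((X i - b) * (X i - K))
      = q i * (X i - E) ^ 2 + ((2 * E - b - K) * (q i * X i) + (b * K - E ^ 2) * q i) := by
    intro i
    ring
  rw [Finset.sum_congr rfl fun i _ => h1 i, Finset.sum_add_distrib, Finset.sum_add_distrib,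
    ← Finset.mul_sum, ← Finset.mul_sum, ← hE, hq1]
  ring

theorem le_sum_mul (hq : ∀ i ∈ A, 0 ≤ q i) (hq1 : ∑ i ∈ A, q i = 1) {b : ℝ}
    (hX : ∀ i ∈ A, 0 < q i → b ≤ X i) : b ≤ ∑ i ∈ A, q i * X i := by
  rw [← one_mul b, ← hq1, Finset.sum_mul]
  refine Finset.sum_le_sum fun i hi => ?_
  rcases (hq i hi).eq_or_lt with h | h
  · simp [← h]
  · exact mul_le_mul_of_nonneg_left (hX i hi h) h.le

/-- The Bhatia-Davis inequality: `(X - b) (X - K) ≤ 0` wherever the weight is positive. -/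
theorem variance_le_of_mem_Icc (hq : ∀ i ∈ A, 0 ≤ q i) (hq1 : ∑ i ∈ A, q i = 1) {b K : ℝ}
    (hX : ∀ i ∈ A, 0 < q i → b ≤ X i ∧ X i ≤ K) :
    ∑ i ∈ A, q i * (X i - ∑ i ∈ A, q i * X i) ^ 2
      ≤ (∑ i ∈ A, q i * X i - b) * (K - ∑ i ∈ A, q i * X i) := by
  have h := sum_mul_sub_mul_sub (X := X) hq1 b K
  have h' : ∑ i ∈ A, q i * ((X i - b) * (X i - K)) ≤ 0 := by
    refine Finset.sum_nonpos fun i hi => ?_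
    rcases (hq i hi).eq_or_lt with h | h
    · simp [← h]
    · obtain ⟨h1, h2⟩ := hX i hi h
      exact mul_nonpos_of_nonneg_of_nonpos h.le
        (mul_nonpos_of_nonneg_of_nonpos (sub_nonneg.mpr h1) (sub_nonpos.mpr h2))
  linarith

end Moments

/-! ### Relative variance of the information content of the outputs. -/

theorem one_le_logb_one_div_one_sub {r : ℝ} (h1 : r < 1) (h : 1 / 2 < r) :
    1 ≤ Real.logb 2 (1 / (1 - r)) := by
  have h0 : 0 < 1 - r := by linarith
  rw [Real.le_logb_iff_rpow_le one_lt_two (by positivity), Real.rpow_one, le_div_iff₀ h0]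
  linarith

namespace PropForm

variable {n m : ℕ} {φ : PropForm (Fin n ⊕ Fin m)}

theorem log_outProb_le (hs : φ.sol.Nonempty) {σ : Fin m → Bool} (hσ : 0 < φ.outProb σ) :
    Real.logb 2 (1 / φ.outProb σ) ≤ n := by
  rw [Real.logb_le_iff_le_rpow one_lt_two (by positivity), Real.rpow_natCast,
    one_div_le hσ (by positivity)]
  exact one_div_two_pow_le_outProb hs hσ.ne'

theorem le_log_outProb {σ : Fin m → Bool} (hσ : 0 < φ.outProb σ) {u : ℝ}
    (h : φ.outProb σ ≤ u) : Real.logb 2 (1 / u) ≤ Real.logb 2 (1 / φ.outProb σ) :=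
  Real.logb_le_logb_of_le one_lt_two (one_div_pos.mpr (hσ.trans_le h))
    (one_div_le_one_div_of_le hσ h)

theorem one_le_log_outProb {σ : Fin m → Bool} (hσ : 0 < φ.outProb σ)
    (h : φ.outProb σ ≤ 1 / 2) :
    1 ≤ Real.logb 2 (1 / φ.outProb σ) := by
  simpa using le_log_outProb hσ h

theorem entropy_eq_sum (φ : PropForm (Fin n ⊕ Fin m)) :
    φ.entropy = ∑ σ, φ.outProb σ * Real.logb 2 (1 / φ.outProb σ) := by
  rw [entropy, ← Finset.sum_neg_distrib]
  refine Finset.sum_congr rfl fun σ _ => ?_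
  rw [one_div, Real.logb_inv, mul_neg]

end PropForm

namespace EntropyEstimation

open PropForm OracleAlg

variable {n m : ℕ} {φ : PropForm (Fin n ⊕ Fin m)}

theorem card_sol_le (ψ : PropForm (Fin m)) : ψ.sol.card ≤ 2 ^ m :=
  (Finset.card_le_univ _).trans_eq (by simp)

theorem one_le_logb_natCast (hm : 2 ≤ m) : 1 ≤ Real.logb 2 (m : ℝ) := by
  have hm' : (2 : ℝ) ≤ m := by exact_mod_cast hm
  rw [Real.le_logb_iff_rpow_le one_lt_two (by linarith), Real.rpow_one]
  exact hm'

theorem sum_outProb_const_true (hφ : φ.IsCircuit) (hs : φ.sol.Nonempty) :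
    ∑ σ ∈ (const true : PropForm (Fin m)).sol, φ.outProb σ = 1 := by
  rw [sol_const_true, sum_outProb hφ hs]

theorem condProb_const_true (hφ : φ.IsCircuit) (hs : φ.sol.Nonempty) (σ : Fin m → Bool) :
    condProb φ (const true) σ = φ.outProb σ := by
  rw [condProb, sum_outProb_const_true hφ hs, div_one]

theorem condMean_const_true (hφ : φ.IsCircuit) (hs : φ.sol.Nonempty) :
    condMean φ (const true) = φ.entropy := by
  simp only [condMean, condProb_const_true hφ hs, sol_const_true, entropy_eq_sum]

theorem one_le_condMean_const_true (hφ : φ.IsCircuit) (hs : φ.sol.Nonempty)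
    (hlow : ∀ σ, φ.outProb σ ≤ 1 / 2) : 1 ≤ condMean φ (const true) := by
  refine le_sum_mul (fun σ _ => condProb_nonneg _ _ σ)
    (sum_condProb (by rw [sum_outProb_const_true hφ hs]; exact one_pos)) fun σ _ hσ => ?_
  rw [condProb_const_true hφ hs] at hσ
  exact one_le_log_outProb hσ (hlow σ)

theorem condVar_const_true_le (hφ : φ.IsCircuit) (hs : φ.sol.Nonempty)
    (hlow : ∀ σ, φ.outProb σ ≤ 1 / 2) (hm : 2 ≤ m) :
    condVar φ (const true) ≤ (min (n : ℝ)
      ((m : ℝ) + Real.logb 2 ((m : ℝ) + Real.logb 2 (m : ℝ) + 1.1)) - 1)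
        * condMean φ (const true) ^ 2 := by
  have hE := one_le_condMean_const_true hφ hs hlow
  have hm' : (2 : ℝ) ≤ m := by exact_mod_cast hm
  have hsum := sum_condProb (φ := φ) (ψ := const true)
    (by rw [sum_outProb_const_true hφ hs]; exact one_pos)
  have hD : (4 : ℝ) ≤ (m : ℝ) + Real.logb 2 (m : ℝ) + 1.1 := by
    linarith [one_le_logb_natCast hm]
  set D : ℝ := (m : ℝ) + Real.logb 2 (m : ℝ) + 1.1
  have hK4 : 4 ≤ m + Real.logb 2 D := by linarith [two_le_logb_four hD]
  rcases min_choice (n : ℝ) ((m : ℝ) + Real.logb 2 D) with h | h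
  · rw [h]
    have hV := variance_le_of_mem_Icc (X := fun σ => Real.logb 2 (1 / φ.outProb σ)) (b := 1)
      (K := n) (fun σ _ => condProb_nonneg φ (const true) σ) hsum fun σ _ hσ => by
        rw [condProb_const_true hφ hs] at hσ
        exact ⟨one_le_log_outProb hσ (hlow σ), log_outProb_le hs hσ⟩
    have hn : condMean φ (const true) ≤ n := by
      have := le_sum_mul (X := fun σ => - Real.logb 2 (1 / φ.outProb σ)) (b := -(n : ℝ))
        (fun σ _ => condProb_nonneg φ (const true) σ) hsum fun σ _ hσ => by
          rw [condProb_const_true hφ hs] at hσ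
          exact neg_le_neg (log_outProb_le hs hσ)
      simp only [mul_neg, Finset.sum_neg_distrib] at this
      exact neg_le_neg_iff.mp this
    change condVar φ (const true)
      ≤ (condMean φ (const true) - 1) * (n - condMean φ (const true)) at hV
    refine hV.trans ?_
    rw [mul_comm]
    exact mul_le_mul (by linarith) (by nlinarith) (by linarith) (by linarith)
  · rw [h]
    have hV := sum_mul_log_sub_mul_log_sub_le (q := φ.outProb) hm
      (card_sol_le (const true)) (fun σ _ => φ.outProb_nonneg σ) hD zero_le_one le_rfl
      fun σ _ hσ => one_le_log_outProb hσ (hlow σ)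
    have hid := sum_mul_sub_mul_sub (X := fun σ => Real.logb 2 (1 / φ.outProb σ)) hsum 1
      (m + Real.logb 2 D)
    change _ = condVar φ (const true) + (condMean φ (const true) - 1) *
      (condMean φ (const true) - (m + Real.logb 2 D)) at hid
    simp only [condProb_const_true hφ hs] at hid
    rw [hid] at hV
    set E := condMean φ (const true)
    set K := m + Real.logb 2 D
    -- The variance is at most `(K - 1) + (E - 1) * (K - E) = (K - 1) * E - (E - 1) ^ 2`, and `E ≤ E
    -- ^ 2`.
    nlinarith [mul_nonneg (sub_nonneg.mpr hE) (sub_nonneg.mpr hE),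
      mul_nonneg (mul_nonneg (sub_nonneg.mpr hE) (zero_le_one.trans hE))
        (show 0 ≤ K - 1 by linarith)]

variable {x : Fin m → Bool}

theorem sum_outProb_neAssignment (hφ : φ.IsCircuit) (hs : φ.sol.Nonempty) :
    ∑ σ ∈ (neAssignment x).sol, φ.outProb σ = 1 - φ.outProb x := by
  rw [sol_neAssignment, ← sum_outProb hφ hs, ← Finset.add_sum_erase _ _ (Finset.mem_univ x)]
  ring

theorem outProb_le_of_ne (hφ : φ.IsCircuit) (hs : φ.sol.Nonempty)
    {σ : Fin m → Bool} (h : σ ≠ x) : φ.outProb σ ≤ 1 - φ.outProb x := by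
  rw [← sum_outProb_neAssignment hφ hs]
  exact Finset.single_le_sum (fun σ _ => φ.outProb_nonneg σ) (by simp [sol_neAssignment, h])

theorem entropy_eq_add (hφ : φ.IsCircuit) (hs : φ.sol.Nonempty) (h1 : φ.outProb x < 1) :
    φ.entropy = (1 - φ.outProb x) * condMean φ (neAssignment x)
      + φ.outProb x * Real.logb 2 (1 / φ.outProb x) := by
  rw [entropy_eq_sum, ← Finset.add_sum_erase _ _ (Finset.mem_univ x), ← sol_neAssignment,
    add_comm, condMean, Finset.mul_sum]
  congr 1
  refine Finset.sum_congr rfl fun σ _ => ?_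
  rw [condProb, sum_outProb_neAssignment hφ hs]
  have : 1 - φ.outProb x ≠ 0 := by linarith
  field_simp

theorem outProb_eq_mul_condProb (hφ : φ.IsCircuit) (hs : φ.sol.Nonempty)
    (h1 : φ.outProb x < 1) (σ : Fin m → Bool) :
    φ.outProb σ = (1 - φ.outProb x) * condProb φ (neAssignment x) σ := by
  rw [condProb, sum_outProb_neAssignment hφ hs]
  have : 1 - φ.outProb x ≠ 0 := by linarith
  field_simp

theorem log_outProb_mem_Icc (hφ : φ.IsCircuit) (hs : φ.sol.Nonempty)
    (h1 : φ.outProb x < 1) {σ : Fin m → Bool} (hσ : σ ∈ (neAssignment x).sol)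
    (hpos : 0 < condProb φ (neAssignment x) σ) :
    Real.logb 2 (1 / (1 - φ.outProb x)) ≤ Real.logb 2 (1 / φ.outProb σ) ∧
      Real.logb 2 (1 / φ.outProb σ) ≤ n := by
  have hp : 0 < φ.outProb σ := by
    rw [outProb_eq_mul_condProb hφ hs h1]
    exact mul_pos (by linarith) hpos
  rw [sol_neAssignment, Finset.mem_erase] at hσ
  exact ⟨le_log_outProb hp (outProb_le_of_ne hφ hs hσ.1), log_outProb_le hs hp⟩

theorem le_condMean_neAssignment (hφ : φ.IsCircuit) (hs : φ.sol.Nonempty)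
    (h1 : φ.outProb x < 1) :
    Real.logb 2 (1 / (1 - φ.outProb x)) ≤ condMean φ (neAssignment x) := by
  refine le_sum_mul (fun σ _ => condProb_nonneg _ _ σ)
    (sum_condProb (by rw [sum_outProb_neAssignment hφ hs]; linarith)) fun σ hσ hpos => ?_
  exact (log_outProb_mem_Icc hφ hs h1 hσ hpos).1

theorem condVar_neAssignment_le (hφ : φ.IsCircuit) (hs : φ.sol.Nonempty)
    (h1 : φ.outProb x < 1) (hx : 1 / 2 < φ.outProb x) (hm : 2 ≤ m) :
    condVar φ (neAssignment x) ≤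
      min ((n : ℝ) / (2 * Real.logb 2 (1 / (1 - φ.outProb x))))
        ((m : ℝ) + Real.logb 2 ((m : ℝ) + Real.logb 2 (m : ℝ) + 2.5))
        * condMean φ (neAssignment x) ^ 2 := by
  have h0 : 0 < 1 - φ.outProb x := by linarith
  have ha := one_le_logb_one_div_one_sub h1 hx
  have haE := le_condMean_neAssignment hφ hs h1
  have hm' : (2 : ℝ) ≤ m := by exact_mod_cast hm
  have hsum := sum_condProb (φ := φ) (ψ := neAssignment x)
    (by rw [sum_outProb_neAssignment hφ hs]; exact h0)
  have hD : (4 : ℝ) ≤ (m : ℝ) + Real.logb 2 (m : ℝ) + 2.5 := by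
    linarith [one_le_logb_natCast hm]
  set D : ℝ := (m : ℝ) + Real.logb 2 (m : ℝ) + 2.5
  have hK4 : 4 ≤ m + Real.logb 2 D := by linarith [two_le_logb_four hD]
  set a := Real.logb 2 (1 / (1 - φ.outProb x)) with hadef
  rcases min_choice ((n : ℝ) / (2 * a)) ((m : ℝ) + Real.logb 2 D) with h | h
  · rw [h]
    have hV := variance_le_of_mem_Icc (X := fun σ => Real.logb 2 (1 / φ.outProb σ)) (b := a)
      (K := n) (fun σ _ => condProb_nonneg φ (neAssignment x) σ) hsum fun σ hσ hpos =>
        log_outProb_mem_Icc hφ hs h1 hσ hpos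
    change condVar φ (neAssignment x)
      ≤ (condMean φ (neAssignment x) - a) * (n - condMean φ (neAssignment x)) at hV
    refine hV.trans ?_
    set E := condMean φ (neAssignment x)
    -- It suffices that `2 * a * (E - a) ≤ E ^ 2`, which holds because the difference is `(E - a) ^
    -- 2 + a ^ 2`.
    rw [div_mul_eq_mul_div, le_div_iff₀ (by linarith)]
    have hn : (0 : ℝ) ≤ n := n.cast_nonneg
    nlinarith [mul_nonneg hn (sq_nonneg (E - a)), mul_nonneg hn (sq_nonneg a),
      mul_nonneg (mul_nonneg (sub_nonneg.mpr haE) (show 0 ≤ E by linarith))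
        (show 0 ≤ a by linarith)]
  · rw [h]
    -- Conditioning shifts the information content by the constant `a`, so the bound for the
    -- conditional distribution applies with lower bound `0`.
    have hY : ∀ σ, 0 < condProb φ (neAssignment x) σ →
        Real.logb 2 (1 / φ.outProb σ) = a + Real.logb 2 (1 / condProb φ (neAssignment x) σ) := by
      intro σ hσ
      rw [outProb_eq_mul_condProb hφ hs h1, ← one_div_mul_one_div,
        Real.logb_mul (by positivity) (by positivity)]
    have hV := sum_mul_log_sub_mul_log_sub_le (q := condProb φ (neAssignment x)) hm
      (card_sol_le (neAssignment x)) (fun σ _ => condProb_nonneg _ _ σ) hD le_rfl zero_le_one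
      fun σ hσ hpos => by
        linarith [hY σ hpos, (log_outProb_mem_Icc hφ hs h1 hσ hpos).1]
    have hid := sum_mul_sub_mul_sub (X := fun σ => Real.logb 2 (1 / φ.outProb σ)) hsum a
      (a + (m + Real.logb 2 D))
    change _ = condVar φ (neAssignment x) + (condMean φ (neAssignment x) - a) *
      (condMean φ (neAssignment x) - (a + (m + Real.logb 2 D))) at hid
    have heq : ∀ σ ∈ (neAssignment x).sol, condProb φ (neAssignment x) σ *
        ((Real.logb 2 (1 / φ.outProb σ) - a) *
          (Real.logb 2 (1 / φ.outProb σ) - (a + (m + Real.logb 2 D))))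
        = condProb φ (neAssignment x) σ *
        ((Real.logb 2 (1 / condProb φ (neAssignment x) σ) - 0) *
          (Real.logb 2 (1 / condProb φ (neAssignment x) σ) - (m + Real.logb 2 D))) := by
      intro σ _
      rcases (condProb_nonneg φ (neAssignment x) σ).eq_or_lt with h | h
      · simp [← h]
      · rw [hY σ h]
        ring
    rw [Finset.sum_congr rfl heq] at hid
    rw [hid] at hV
    set E := condMean φ (neAssignment x)
    set K := m + Real.logb 2 D
    -- The variance is at most `K - 1 + (E - a) * (K - (E - a)) ≤ K * (1 + E - a) ≤ K * E ≤ K * E ^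
    -- 2`, as `a ≥ 1` and `E ≥ 1`.
    nlinarith [mul_nonneg (sub_nonneg.mpr haE) (sub_nonneg.mpr haE),
      mul_nonneg (show 0 ≤ E - 1 by linarith) (show 0 ≤ K * E by nlinarith),
      mul_nonneg (show 0 ≤ a - 1 by linarith) (show 0 ≤ K by linarith)]

end EntropyEstimation

/-! ### Correctness of the returned value. -/

namespace EntropyEstimation

open PropForm OracleAlg

variable {n m : ℕ} {φ : PropForm (Fin n ⊕ Fin m)}
  {junk : PropForm (Fin n ⊕ Fin m) → Fin n ⊕ Fin m → Bool}

theorem le_batch (x : ℝ) : x ≤ batch x :=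
  (Nat.le_ceil x).trans (by exact_mod_cast le_max_right _ _)

theorem batch_pos (x : ℝ) : 0 < batch x :=
  lt_of_lt_of_le one_pos (le_max_left _ _)

/-- The interval of acceptable estimates. -/
def approxEntropy (φ : PropForm (Fin n ⊕ Fin m)) (ε : ℝ) : Set ℝ :=
  Set.Icc ((1 - ε) * φ.entropy) ((1 + ε) * φ.entropy)

theorem expect_sampleEst_low_fail_le (hm : 2 ≤ m) (hφ : φ.IsCircuit) (hs : φ.sol.Nonempty)
    (hlow : ∀ σ, φ.outProb σ ≤ 1 / 2) {ε δ : ℝ} (hε : 0 < ε) (h0 : 0 < δ) (h2 : δ ≤ 2) :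
    expect junk (sampleEst φ (const true) (batchLow n m ε) δ) ((approxEntropy φ ε)ᶜ.indicator 1)
      ≤ ENNReal.ofReal δ := by
  rw [approxEntropy, ← condMean_const_true hφ hs]
  refine expect_sampleEst_fail_le h0 h2 (expect_sampleSum_fail_le hφ hs ?_ hε (batch_pos _)
    (one_pos.trans_le (one_le_condMean_const_true hφ hs hlow)) (le_batch _)
    (condVar_const_true_le hφ hs hlow hm))
  rw [sum_outProb_const_true hφ hs]
  exact one_pos

theorem expect_high_fail_le (hm : 2 ≤ m) (hφ : φ.IsCircuit) (hs : φ.sol.Nonempty)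
    {x : Fin m → Bool} (hx : 1 / 2 < φ.outProb x) {ε δ : ℝ} (hε : 0 < ε) (h0 : 0 < δ)
    (h2 : δ ≤ 2) :
    expect junk (sampleEst φ (neAssignment x) (batchHigh n m ε (φ.outProb x)) δ)
      (fun h => (approxEntropy φ ε)ᶜ.indicator 1
        ((1 - φ.outProb x) * h + φ.outProb x * Real.logb 2 (1 / φ.outProb x)))
      ≤ ENNReal.ofReal δ := by
  rcases (outProb_le_one hφ hs x).eq_or_lt with h1 | h1
  -- If `r = 1`, the sampler is asked about an unsatisfiable formula, but its answers are multiplied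
  -- by `1 - r = 0`: the returned value is `0`, which is the entropy.
  · have hent : φ.entropy = 0 := by
      rw [entropy_eq_sum]
      refine Finset.sum_eq_zero fun σ _ => ?_
      by_cases hσ : σ = x
      · simp [hσ, h1]
      · have := outProb_le_of_ne hφ hs hσ
        rw [h1, sub_self] at this
        rw [this.antisymm (φ.outProb_nonneg σ), zero_mul]
    simp [h1, hent, approxEntropy, expect_const]
  · have ha := one_le_logb_one_div_one_sub h1 hx
    refine (expect_mono _ fun h => ?_).trans
      (expect_sampleEst_fail_le h0 h2 (expect_sampleSum_fail_le hφ hs ?_ hε (batch_pos _)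
        (one_pos.trans_le (ha.trans (le_condMean_neAssignment hφ hs h1))) (le_batch _)
        (condVar_neAssignment_le hφ hs h1 hx hm)))
    · by_cases hh : h ∈ Set.Icc ((1 - ε) * condMean φ (neAssignment x))
        ((1 + ε) * condMean φ (neAssignment x))
      · rw [Set.indicator_of_notMem]
        · exact zero_le
        rw [Set.notMem_compl_iff, approxEntropy, entropy_eq_add hφ hs h1]
        -- The exactly known summand is nonnegative, so relative error `ε` in the other summand
        -- gives relative error at most `ε` in the total.
        have hr : 0 ≤ φ.outProb x * Real.logb 2 (1 / φ.outProb x) :=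
          mul_nonneg (φ.outProb_nonneg x) (Real.logb_nonneg one_lt_two
            ((one_le_div (by linarith)).mpr h1.le))
        have hs' : 0 ≤ 1 - φ.outProb x := by linarith
        constructor
        · nlinarith [mul_le_mul_of_nonneg_left hh.1 hs']
        · nlinarith [mul_le_mul_of_nonneg_left hh.2 hs']
      · rw [Set.indicator_of_mem (s := (Set.Icc _ _)ᶜ) hh]
        exact Set.indicator_le_self' (fun _ _ => zero_le) _
    · rw [sum_outProb_neAssignment hφ hs]
      linarith

theorem mainLoop_succ (ε δ : ℝ) (i : ℕ) (g : ℝ → ℝ≥0∞) :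
    expect junk (mainLoop φ ε δ (i + 1)) g = expect junk (proc φ (const true)) fun xr =>
      if xr.2 > 1 / 2 then expect junk (sampleEst φ (neAssignment xr.1) (batchHigh n m ε xr.2)
        (0.9 * δ)) fun h => g ((1 - xr.2) * h + xr.2 * Real.logb 2 (1 / xr.2))
      else expect junk (mainLoop φ ε δ i) g := by
  rw [mainLoop, expect_bind]
  congr 1
  funext xr
  split_ifs with h
  · rw [expect_bind]
    rfl
  · rfl

theorem expect_indicator_le_one {α : Type} (A : OracleAlg n m α) (S : Set α) :
    expect junk A (S.indicator 1) ≤ 1 :=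
  (expect_mono A fun _ => Set.indicator_le_self' (fun _ _ => zero_le) _).trans_eq
    (expect_const A 1)

/-- If some output has probability more than `1 / 2`, then each round finds it with probability
at least `1 / 2`. -/
theorem expect_mainLoop_fail_le_of_high (hm : 2 ≤ m) (hφ : φ.IsCircuit) (hs : φ.sol.Nonempty)
    {x : Fin m → Bool} (hx : 1 / 2 < φ.outProb x) {ε δ : ℝ} (hε : 0 < ε) (h0 : 0 < δ)
    (h2 : 0.9 * δ ≤ 2) (i : ℕ) :
    expect junk (mainLoop φ ε δ i) ((approxEntropy φ ε)ᶜ.indicator 1)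
      ≤ ENNReal.ofReal (0.9 * δ + (1 / 2) ^ i) := by
  induction i with
  | zero =>
    refine (expect_indicator_le_one _ _).trans ?_
    rw [← ENNReal.ofReal_one]
    exact ENNReal.ofReal_le_ofReal (by norm_num; positivity)
  | succ i ih =>
    have h0' : 0 < 0.9 * δ := by positivity
    rw [mainLoop_succ]
    have hsum := sum_outProb_const_true hφ hs
    have hstep : ∀ xr : (Fin m → Bool) × ℝ, xr.2 = φ.outProb xr.1 →
        (if xr.2 > 1 / 2 then expect junk (sampleEst φ (neAssignment xr.1)
          (batchHigh n m ε xr.2) (0.9 * δ)) fun h => (approxEntropy φ ε)ᶜ.indicator 1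
            ((1 - xr.2) * h + xr.2 * Real.logb 2 (1 / xr.2))
        else expect junk (mainLoop φ ε δ i) ((approxEntropy φ ε)ᶜ.indicator 1))
        ≤ ENNReal.ofReal (0.9 * δ + if xr.2 > 1 / 2 then 0 else (1 / 2) ^ i) := by
      rintro ⟨y, r⟩ (rfl : r = φ.outProb y)
      split_ifs with h
      · rw [add_zero]
        exact expect_high_fail_le hm hφ hs h hε h0' h2
      · exact ih
    refine (expect_proc_mono hstep).trans ?_
    rw [expect_proc hφ hs _ (by rw [hsum]; exact one_pos)
      (fun xr => 0.9 * δ + if xr.2 > 1 / 2 then 0 else (1 / 2) ^ i)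
      fun xr => by positivity]
    apply ENNReal.ofReal_le_ofReal
    simp only [hsum, div_one, mul_add, Finset.sum_add_distrib, ← Finset.sum_mul, one_mul]
    gcongr
    -- Drawing `x` ends the search, so the failure term `(1 / 2) ^ i` is charged only to the other
    -- outputs, of total probability `1 - p_x ≤ 1 / 2`.
    rw [sol_const_true, ← Finset.add_sum_erase _ _ (Finset.mem_univ x), if_pos hx, mul_zero,
      zero_add]
    calc _ ≤ ∑ σ ∈ Finset.univ.erase x, φ.outProb σ * (1 / 2) ^ i := by
          refine Finset.sum_le_sum fun σ _ => mul_le_mul_of_nonneg_left ?_ (φ.outProb_nonneg σ)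
          split_ifs
          · positivity
          · rfl
      _ = (1 - φ.outProb x) * (1 / 2) ^ i := by
          rw [← Finset.sum_mul, ← sol_neAssignment, sum_outProb_neAssignment hφ hs]
      _ ≤ (1 / 2) * (1 / 2) ^ i := by
          gcongr
          linarith
      _ = (1 / 2) ^ (i + 1) := by rw [pow_succ']

theorem expect_mainLoop_fail_le_of_low (hm : 2 ≤ m) (hφ : φ.IsCircuit) (hs : φ.sol.Nonempty)
    (hlow : ∀ σ, φ.outProb σ ≤ 1 / 2) {ε δ : ℝ} (hε : 0 < ε) (h0 : 0 < δ)
    (h2 : 0.9 * δ ≤ 2) (i : ℕ) :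
    expect junk (mainLoop φ ε δ i) ((approxEntropy φ ε)ᶜ.indicator 1)
      ≤ ENNReal.ofReal (0.9 * δ) := by
  induction i with
  | zero => exact expect_sampleEst_low_fail_le hm hφ hs hlow hε (by positivity) h2
  | succ i ih =>
    rw [mainLoop_succ]
    refine (expect_proc_mono (g := fun _ => ENNReal.ofReal (0.9 * δ)) fun xr hxr => ?_).trans_eq
      (expect_const _ _)
    rw [if_neg (by rw [hxr]; exact not_lt.mpr (hlow _))]
    exact ih

theorem half_pow_ceil_logb_le {δ : ℝ} (h0 : 0 < δ) :
    (1 / 2 : ℝ) ^ ⌈Real.logb 2 (10 / δ)⌉₊ ≤ 0.1 * δ := by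
  have h := Nat.le_ceil (Real.logb 2 (10 / δ))
  rw [one_div, inv_pow, inv_le_comm₀ (by positivity) (by positivity), ← Real.rpow_natCast]
  calc (0.1 * δ)⁻¹ = 2 ^ Real.logb 2 (10 / δ) := by
        rw [Real.rpow_logb two_pos (by norm_num) (by positivity)]
        field_simp
        norm_num
    _ ≤ _ := Real.rpow_le_rpow_of_exponent_le one_le_two h

theorem le_main_toMeasure (hm : 2 ≤ m) (hφ : φ.IsCircuit) (hs : φ.sol.Nonempty) {ε δ : ℝ}
    (hε : 0 < ε) (h0 : 0 < δ) :
    ENNReal.ofReal (1 - δ) ≤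
      ((main φ ε δ).run junk).toMeasure {hc : ℝ × ℕ | hc.1 ∈ approxEntropy φ ε} := by
  -- For `δ ≥ 1` the claim is void; otherwise `0.9 * δ ≤ 2`, as the bound on the number of rounds
  -- requires.
  rcases le_or_gt 1 δ with h1 | h1
  · rw [ENNReal.ofReal_of_nonpos (by linarith)]
    exact zero_le
  · refine le_run_toMeasure _ _ ?_ h0.le
    have h2 : 0.9 * δ ≤ 2 := by linarith
    by_cases hlow : ∀ σ, φ.outProb σ ≤ 1 / 2
    · refine (expect_mainLoop_fail_le_of_low hm hφ hs hlow hε h0 h2 _).trans ?_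
      exact ENNReal.ofReal_le_ofReal (by linarith)
    · push Not at hlow
      obtain ⟨x, hx⟩ := hlow
      refine (expect_mainLoop_fail_le_of_high hm hφ hs hx hε h0 h2 _).trans ?_
      exact ENNReal.ofReal_le_ofReal (by linarith [half_pow_ceil_logb_le h0])

/-! ### Number of queries. -/

section Queries

variable {ψ : PropForm (Fin m)}

theorem always_sampleSum (j : ℕ) (s : ℝ) :
    Always junk (sampleSum φ ψ j s) fun _ c => c = 3 * j := by
  induction j generalizing s with
  | zero => exact rfl
  | succ j ih =>
    refine Always.bind (always_proc fun σ => (ih _).mono fun _ c hc => ?_)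
    omega

theorem always_sampleMeans (t i : ℕ) (L : List ℝ) :
    Always junk (sampleMeans φ ψ t i L) fun _ c => c = i * (3 * t) := by
  induction i generalizing L with
  | zero => exact (Nat.zero_mul _).symm
  | succ i ih =>
    refine Always.bind ((always_sampleSum t 0).mono fun _ c hc => (ih _).mono fun _ d hd => ?_)
    rw [hc, hd]
    ring

theorem always_sampleEst (t : ℕ) (δ : ℝ) : Always junk (sampleEst φ ψ t δ) fun _ c =>
    c = ⌈(9 / 2 : ℝ) * Real.logb 2 (2 / δ)⌉₊ * (3 * t) :=
  Always.bind ((always_sampleMeans t _ []).mono fun _ _ hc => hc)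

/-- Here `t` dominates both batch sizes. The restriction to `1 / 2 < r ≤ 1` loses nothing, since
`PROC` returns true probabilities. -/
theorem always_mainLoop (hφ : φ.IsCircuit) (hs : φ.sol.Nonempty) {ε δ : ℝ} {t : ℕ}
    (hlow : batchLow n m ε ≤ t)
    (hhigh : ∀ r : ℝ, 1 / 2 < r → r ≤ 1 → batchHigh n m ε r ≤ t) (i : ℕ) :
    Always junk (mainLoop φ ε δ i) fun _ c =>
      c ≤ 3 * i + ⌈(9 / 2 : ℝ) * Real.logb 2 (2 / (0.9 * δ))⌉₊ * (3 * t) := by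
  induction i with
  | zero =>
    refine (always_sampleEst _ _).mono fun _ c hc => ?_
    rw [hc, mul_zero, zero_add]
    gcongr
  | succ i ih =>
    refine Always.bind (always_proc fun σ => ?_)
    split_ifs with h
    · refine Always.bind ((always_sampleEst _ _).mono fun _ c hc => ?_)
      change 3 + (c + 0) ≤ _
      have := hhigh _ h (outProb_le_one hφ hs σ)
      have : c ≤ ⌈(9 / 2 : ℝ) * Real.logb 2 (2 / (0.9 * δ))⌉₊ * (3 * t) := by
        rw [hc]
        gcongr
      omega
    · refine ih.mono fun _ c hc => ?_
      omega

theorem batch_le {x y : ℝ} (h : x ≤ y) (hy : 0 ≤ y) : (batch x : ℝ) ≤ y + 1 := by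
  rw [batch, Nat.cast_max, Nat.cast_one]
  refine max_le (by linarith) ?_
  rcases le_or_gt x 0 with hx | hx
  · rw [Nat.ceil_eq_zero.mpr hx, Nat.cast_zero]
    linarith
  · exact (Nat.ceil_lt_add_one hx.le).le.trans (by linarith)

/-- A crude bound: `m + log m + c ≤ 4 ^ m`, whose logarithm is `2 * m`. With the factor `6` of the
batch size this gives the `18` below. -/
theorem add_logb_le {m : ℕ} (hm : 2 ≤ m) {c : ℝ} (hc0 : 0 ≤ c) (hc : c ≤ 2.5) :
    (m : ℝ) + Real.logb 2 ((m : ℝ) + Real.logb 2 (m : ℝ) + c) ≤ 3 * m := by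
  have hm' : (2 : ℝ) ≤ m := by exact_mod_cast hm
  have hpow : (m : ℝ) ≤ 2 ^ m := by exact_mod_cast Nat.lt_two_pow_self.le
  have hlog : Real.logb 2 (m : ℝ) ≤ m := by
    rw [Real.logb_le_iff_le_rpow one_lt_two (by linarith), Real.rpow_natCast]
    exact hpow
  have hlog1 := one_le_logb_natCast hm
  have : Real.logb 2 ((m : ℝ) + Real.logb 2 (m : ℝ) + c) ≤ ((m + m : ℕ) : ℝ) := by
    have h4 : (4 : ℝ) ≤ 2 ^ m := by
      calc (4 : ℝ) = 2 ^ 2 := by norm_num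
        _ ≤ 2 ^ m := pow_le_pow_right₀ one_le_two hm
    rw [Real.logb_le_iff_le_rpow one_lt_two (by linarith), Real.rpow_natCast, pow_add]
    nlinarith
  push_cast at this
  linarith

theorem batchLow_le (hm : 2 ≤ m) (ε : ℝ) :
    (batchLow n m ε : ℝ) ≤ 18 * (min (m : ℝ) (n : ℝ) / ε ^ 2) + 1 := by
  refine batch_le ?_ (by positivity)
  rw [div_mul_eq_mul_div, ← mul_div_assoc]
  gcongr ?_ / _
  have h1 := min_le_left (n : ℝ) ((m : ℝ) + Real.logb 2 ((m : ℝ) + Real.logb 2 (m : ℝ) + 1.1))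
  have h2 := min_le_right (n : ℝ) ((m : ℝ) + Real.logb 2 ((m : ℝ) + Real.logb 2 (m : ℝ) + 1.1))
  have h3 := add_logb_le hm (c := 1.1) (by norm_num) (by norm_num)
  have hn : (0 : ℝ) ≤ n := n.cast_nonneg
  rcases min_choice (m : ℝ) (n : ℝ) with h | h <;> rw [h] <;> linarith

theorem batchHigh_le (hm : 2 ≤ m) (ε : ℝ) {r : ℝ} (h : 1 / 2 < r) (h1 : r ≤ 1) :
    (batchHigh n m ε r : ℝ) ≤ 18 * (min (m : ℝ) (n : ℝ) / ε ^ 2) + 1 := by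
  refine batch_le ?_ (by positivity)
  rw [div_mul_eq_mul_div, ← mul_div_assoc]
  gcongr ?_ / _
  have hn : (0 : ℝ) ≤ n := n.cast_nonneg
  have hq : (n : ℝ) / (2 * Real.logb 2 (1 / (1 - r))) ≤ n := by
    rcases h1.eq_or_lt with rfl | h1
    · simp
    · have := one_le_logb_one_div_one_sub h1 h
      exact div_le_self hn (by linarith)
  have h2 := (min_le_left ((n : ℝ) / (2 * Real.logb 2 (1 / (1 - r))))
    ((m : ℝ) + Real.logb 2 ((m : ℝ) + Real.logb 2 (m : ℝ) + 2.5))).trans hq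
  have h3 := (min_le_right ((n : ℝ) / (2 * Real.logb 2 (1 / (1 - r))))
    ((m : ℝ) + Real.logb 2 ((m : ℝ) + Real.logb 2 (m : ℝ) + 2.5))).trans
      (add_logb_le hm (c := 2.5) (by norm_num) le_rfl)
  rcases min_choice (m : ℝ) (n : ℝ) with h | h <;> rw [h] <;> linarith

theorem ceil_le_of_le {x y : ℝ} (h : x ≤ y) (hy : 0 ≤ y) : (⌈x⌉₊ : ℝ) ≤ y + 1 :=
  (Nat.cast_le.mpr (Nat.ceil_mono h)).trans (Nat.ceil_lt_add_one hy).le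

theorem logb_const_div_le {c δ : ℝ} (hc : 0 < c) (h0 : 0 < δ) {k : ℕ} (hk : c ≤ 2 ^ k) :
    Real.logb 2 (c / δ) ≤ k + Real.logb 2 (1 / δ) := by
  rw [div_eq_mul_one_div, Real.logb_mul hc.ne' (by positivity)]
  gcongr
  rw [Real.logb_le_iff_le_rpow one_lt_two hc, Real.rpow_natCast]
  exact hk

theorem queries_le (hm : 2 ≤ m) (hφ : φ.IsCircuit) (hs : φ.sol.Nonempty) {ε δ : ℝ} (h0 : 0 < δ) :
    ∀ hc ∈ ((main φ ε δ).run junk).support,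
      (hc.2 : ℝ) ≤ 1000 * max 1 (min (m : ℝ) (n : ℝ) / ε ^ 2) * max 1 (Real.logb 2 (1 / δ)) := by
  set M := max 1 (min (m : ℝ) (n : ℝ) / ε ^ 2)
  set L := max 1 (Real.logb 2 (1 / δ))
  have hM1 : 1 ≤ M := le_max_left _ _
  have hM : min (m : ℝ) (n : ℝ) / ε ^ 2 ≤ M := le_max_right _ _
  have hL1 : 1 ≤ L := le_max_left _ _
  have hL : Real.logb 2 (1 / δ) ≤ L := le_max_right _ _
  have hM0 : 0 ≤ 19 * M := by linarith
  have ht : ((⌊19 * M⌋₊ : ℕ) : ℝ) ≤ 19 * M := Nat.floor_le hM0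
  have hrun := (always_mainLoop (junk := junk) hφ hs (ε := ε) (δ := δ) (t := ⌊19 * M⌋₊)
    (Nat.le_floor (by linarith [batchLow_le (n := n) hm ε]))
    (fun r h h1 => Nat.le_floor (by linarith [batchHigh_le (n := n) hm ε h h1]))
    ⌈Real.logb 2 (10 / δ)⌉₊).of_mem_support
  intro hc hhc
  have hle : (hc.2 : ℝ) ≤ 3 * ⌈Real.logb 2 (10 / δ)⌉₊
      + ⌈(9 / 2 : ℝ) * Real.logb 2 (2 / (0.9 * δ))⌉₊ * (3 * ⌊19 * M⌋₊) := by
    exact_mod_cast hrun hc hhc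
  have h1 : (⌈Real.logb 2 (10 / δ)⌉₊ : ℝ) ≤ 5 * L + 1 := by
    refine ceil_le_of_le ?_ (by linarith)
    have := logb_const_div_le (c := 10) (k := 4) (by norm_num) h0 (by norm_num)
    push_cast at this
    linarith
  have h2 : (⌈(9 / 2 : ℝ) * Real.logb 2 (2 / (0.9 * δ))⌉₊ : ℝ) ≤ 27 / 2 * L + 1 := by
    refine ceil_le_of_le ?_ (by linarith)
    have := logb_const_div_le (c := 2 / 0.9) (k := 2) (by norm_num) h0 (by norm_num)
    rw [div_div] at this
    push_cast at this
    linarith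
  calc (hc.2 : ℝ) ≤ 3 * (5 * L + 1) + (27 / 2 * L + 1) * (3 * (19 * M)) := by
        refine hle.trans ?_
        gcongr
    _ ≤ 3 * (6 * L) + (29 / 2 * L) * (3 * (19 * M)) := by
        gcongr <;> linarith
    -- Since `M ≥ 1`, the left side is at most `(18 + 826.5) * M * L`.
    _ ≤ 1000 * M * L := by nlinarith [mul_le_mul_of_nonneg_right hM1 (zero_le_one.trans hL1)]

end Queries

end EntropyEstimation

theorem corollary5 :
    ∃ C : ℝ, 0 < C ∧
      ∀ (n m : ℕ) (φ : PropForm (Fin n ⊕ Fin m)) (ε δ : ℝ)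
        (junk : PropForm (Fin n ⊕ Fin m) → Fin n ⊕ Fin m → Bool),
        2 ≤ m → φ.IsCircuit → φ.sol.Nonempty → 0 < ε → 0 < δ →
        -- every output that occurs has probability at least `2 ^ (-n)`
        (∀ σ : Fin m → Bool, φ.outProb σ ≠ 0 → 1 / (2 : ℝ) ^ n ≤ φ.outProb σ) ∧
        -- correctness
        ENNReal.ofReal (1 - δ) ≤
          ((EntropyEstimation.main φ ε δ).run junk).toMeasure
            {hc : ℝ × ℕ | (1 - ε) * φ.entropy ≤ hc.1 ∧ hc.1 ≤ (1 + ε) * φ.entropy} ∧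
        -- number of counting and sampling queries, on every run
        ∀ hc ∈ ((EntropyEstimation.main φ ε δ).run junk).support,
          (hc.2 : ℝ) ≤
            C * max 1 (min (m : ℝ) (n : ℝ) / ε ^ 2) * max 1 (Real.logb 2 (1 / δ)) := by
  refine ⟨1000, by norm_num, fun n m φ ε δ junk hm hφ hs hε hδ => ⟨fun σ hσ => ?_, ?_, ?_⟩⟩
  · exact PropForm.one_div_two_pow_le_outProb hs hσ
  · exact EntropyEstimation.le_main_toMeasure hm hφ hs hε hδ
  · exact EntropyEstimation.queries_le hm hφ hs hδ
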